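/- Let $n\ge 1$. Write $\mathbf R^{n+1}_+=\mathbf R^n\times(0,\infty)$ and, for open $O\subset\mathbf R^n$, let $TO=\{(x,t): x\in O,\ 0<t<\operatorname{dist}(x,\partial O)\}$ be the tent over $O$ (with $\operatorname{dist}(x,\emptyset)=\infty$). For functions $F,G:[0,\infty)\to[0,\infty)$ write $F\approx G$ if $F\le cG$ and $G\le cF$ for some constant $c$. Let $\Phi:[0,\infty)\to[0,\infty)$ be positive on $(0,\infty)$, equivalent ($\approx$) to a strictly increasing function, with $$\Phi(0)=0,\qquad \Phi(c\,\cdot)\approx\Phi\quad\text{for every } c>0 \text{ (constants depending on } c).$$ Let $\mu$ be a positive Borel measure on $\mathbf R^{n+1}_+$. We say $\mu\in V^\Phi$ if there is $C<\infty$ with $\mu(TO)\le C\,\Phi(|O|^{1/n})$ for all open $O\subset\mathbf R^n$ of finite Lebesgue measure $|O|$. For a strictly increasing $\Psi:[0,\infty)\to[0,\infty)$ put $\Psi^{-1}(y)=\inf\{s\ge 0: y\le\Psi(s)\}\in[0,\infty]$ for $y\in[0,\infty]$ (the usual inverse on the range of $\Psi$). For $1<r<\infty$, $0<q\le\infty$,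 a function $f$ on $\mathbf R^n$ and a function $u$ on $\mathbf R^{n+1}_+$, with $h(\lambda)=\mu\{|u|>\lambda\}$, let $$\|f\|_{L^{r,q}}=\Big(\int_0^\infty |\{|f|>\lambda\}|^{q/r}\,d\lambda^q\Big)^{1/q},\qquad \|u\|_{\Lambda^q_\mu((\Psi^{-1})^{n/r})}=\Big(\int_0^\infty \big[\Psi^{-1}(h(\lambda))\big]^{nq/r}\,d\lambda^q\Big)^{1/q},$$ where $d\lambda^q=q\lambda^{q-1}d\lambda$, and for $q=\infty$ these are $\sup_{\lambda>0}\lambda|\{|f|>\lambda\}|^{1/r}$ and $\sup_{\lambda>0}\lambda[\Psi^{-1}(h(\lambda))]^{n/r}$. A kernel is a measurable function $\phi>0$ on $\mathbf R^n$ which has a non-increasing radial majorant that is integrable and bounded; $\phi_t(x)=t^{-n}\phi(x/t)$. For $f\in L^{r,q}$ the convolution $f*\phi_t(x)$ (absolutely convergent for every $(x,t)\in\mathbf R^{n+1}_+$, and measurable in $(x,t)$) is regarded as a function on $\mathbf R^{n+1}_+$. Functions $f$ may be real or complex valued. Consider the estimate $$\|f*\phi_t\|_{\Lambda^q_\mu((\Psi^{-1})^{n/r})}\le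 C\,\|f\|_{L^{r,q}}\quad\text{for all } f\in L^{r,q},\qquad (\ast)_{\Psi,\phi,r,q}$$ with a constant $C<\infty$ independent of $f$. **Theorem.** Let $\Psi$ be any strictly increasing function with $\Psi\approx\Phi$. 1. If $\mu\in V^\Phi$, then there is a constant $K>0$ such that $(\ast)_{K\Psi,\phi,r,q}$ holds for all kernels $\phi$, all $1<r<\infty$ and all $0<q\le\infty$ (note that $K\Psi\approx\Phi$ as well). 2. If moreover $2\Phi(s)\le\Phi(As)$ for all $s\ge0$, for some constant $A$, then $\mu\in V^\Phi$ implies $(\ast)_{\Psi,\phi,r,q}$ for all kernels $\phi$, all $1<r<\infty$ and all $0<q\le\infty$. 3. Conversely, if $(\ast)_{\Psi,\phi,r,q}$ holds for some kernel $\phi$, some $1<r<\infty$ and some $0<q\le\infty$, then $\mu\in V^\Phi$. -/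

import Mathlib

open MeasureTheory Set
open scoped NNReal ENNReal

/-- Euclidean space `ℝⁿ`. -/
abbrev Rn (n : ℕ) : Type := EuclideanSpace ℝ (Fin n)

/-- The open upper half-space `ℝⁿ × (0, ∞)`. -/
abbrev HalfSpace (n : ℕ) : Type := Rn n × Ioi (0 : ℝ)

/-- The tent over `O`: the points `(x, t)` with `x ∈ O` and `0 < t < dist (x, ∂O)`.
The distance to the empty set is `∞`, so the tent over `ℝⁿ` is the whole half-space. -/
def tent {n : ℕ} (O : Set (Rn n)) : Set (HalfSpace n) :=
  {p | p.1 ∈ O ∧ ENNReal.ofReal (p.2 : ℝ) < Metric.infEDist p.1 (frontier O)}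

/-- `F ≈ G`: two functions `[0, ∞) → [0, ∞)` are bounded by constant multiples of each other. -/
def Comparable (F G : ℝ≥0 → ℝ≥0) : Prop :=
  (∃ C : ℝ≥0, ∀ s, F s ≤ C * G s) ∧ (∃ C : ℝ≥0, ∀ s, G s ≤ C * F s)

/-- The conditions on the gauge function: `Φ` is positive on `(0, ∞)`, `Φ 0 = 0`,
`Φ (c s) ≈ Φ s` for every `c > 0` (constants may depend on `c`), and `Φ` is equivalent to some
strictly increasing function. -/
structure IsGauge (Φ : ℝ≥0 → ℝ≥0) : Prop where
  zero : Φ 0 = 0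
  pos : ∀ s, 0 < s → 0 < Φ s
  dilation : ∀ c : ℝ≥0, 0 < c → Comparable (fun s => Φ (c * s)) Φ
  exists_strictMono : ∃ Ψ : ℝ≥0 → ℝ≥0, StrictMono Ψ ∧ Comparable Ψ Φ

/-- The inverse of a strictly increasing `Ψ : [0, ∞) → [0, ∞)`, as a function on `[0, ∞]`:
`Ψ⁻¹ (y) = inf {s : y ≤ Ψ s}`, with `inf ∅ = ∞`. -/
noncomputable def gaugeInv (Ψ : ℝ≥0 → ℝ≥0) (y : ℝ≥0∞) : ℝ≥0∞ :=
  ⨅ (s : ℝ≥0) (_ : y ≤ (Ψ s : ℝ≥0∞)), (s : ℝ≥0∞)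

/-- For a strictly increasing function, `gaugeInv` inverts it. -/
theorem gaugeInv_apply {Ψ : ℝ≥0 → ℝ≥0} (hΨ : StrictMono Ψ) (s : ℝ≥0) :
    gaugeInv Ψ (Ψ s) = s := by
  apply le_antisymm
  · exact iInf₂_le (f := fun (s' : ℝ≥0) (_ : (Ψ s : ℝ≥0∞) ≤ Ψ s') => (s' : ℝ≥0∞)) s le_rfl
  · refine le_iInf₂ fun s' hs' => ?_
    exact_mod_cast hΨ.le_iff_le.1 (ENNReal.coe_le_coe.1 hs')

/-- The class `V^Φ`: `μ (TO) ≤ C Φ (|O|^{1/n})` for all open `O`.  For `|O| = ∞` the right-hand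
side is `C Φ (∞)`, `Φ (∞) = sup Φ`, and nothing new is required: the tent over `O` is the
increasing union of the tents over the sets `O ∩ B (0, R)`. -/
def MemV {n : ℕ} (Φ : ℝ≥0 → ℝ≥0) (μ : Measure (HalfSpace n)) : Prop :=
  ∃ C : ℝ≥0, ∀ O : Set (Rn n), IsOpen O → volume O ≠ ∞ →
    μ (tent O) ≤ (C * Φ ((volume O).toNNReal ^ ((1 : ℝ) / n)) : ℝ≥0)

/-- For `D : (0, ∞) → [0, ∞]`, the quantity `(∫₀^∞ D (lam) ^ q d(lam ^ q)) ^ (1 / q)`,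
where `d(lam ^ q) = q lam ^ (q - 1) d lam`, and `sup_{lam > 0} lam D (lam)` if `q = ∞`. -/
noncomputable def lorentzFunctional (D : ℝ → ℝ≥0∞) (q : ℝ≥0∞) : ℝ≥0∞ :=
  if q = ∞ then ⨆ (lam : ℝ) (_ : 0 < lam), ENNReal.ofReal lam * D lam
  else (∫⁻ lam in Ioi (0 : ℝ),
      D lam ^ q.toReal * ENNReal.ofReal (q.toReal * lam ^ (q.toReal - 1))) ^ (1 / q.toReal)

/-- The quasi-norm of the Lorentz space `L^{r,q} (ℝⁿ)`, through the distribution function. -/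
noncomputable def lorentzNorm {n : ℕ} {F : Type*} [NormedAddCommGroup F]
    (f : Rn n → F) (r : ℝ) (q : ℝ≥0∞) : ℝ≥0∞ :=
  lorentzFunctional (fun lam => volume {x | lam < ‖f x‖} ^ (1 / r)) q

/-- `f` belongs to the Lorentz space `L^{r,q} (ℝⁿ)`. -/
def MemLorentz {n : ℕ} {F : Type*} [NormedAddCommGroup F]
    (f : Rn n → F) (r : ℝ) (q : ℝ≥0∞) : Prop :=
  AEStronglyMeasurable f volume ∧ lorentzNorm f r q < ∞

/-- The quasi-norm of the weighted Lorentz space `Λ^q_μ ((Ψ⁻¹)^b)` on the half-space: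
`(∫₀^∞ (Ψ⁻¹ (h lam)) ^ (b q) d(lam ^ q)) ^ (1 / q)`, or `sup lam (Ψ⁻¹ (h lam)) ^ b` if `q = ∞`,
with `h lam = μ {|u| > lam}`. -/
noncomputable def weightedLorentzNorm {n : ℕ} {F : Type*} [NormedAddCommGroup F]
    (μ : Measure (HalfSpace n)) (Ψ : ℝ≥0 → ℝ≥0) (b : ℝ) (q : ℝ≥0∞) (u : HalfSpace n → F) :
    ℝ≥0∞ :=
  lorentzFunctional (fun lam => gaugeInv Ψ (μ {p | lam < ‖u p‖}) ^ b) q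

/-- A positive function with a non-increasing radial majorant that is integrable and bounded. -/
structure IsKernel {n : ℕ} (φ : Rn n → ℝ) : Prop where
  measurable : AEStronglyMeasurable φ volume
  pos : ∀ x, 0 < φ x
  majorant : ∃ M : ℝ → ℝ, AntitoneOn M (Ici 0) ∧ (∃ B, ∀ s, 0 ≤ s → M s ≤ B) ∧
    Integrable (fun x : Rn n => M ‖x‖) volume ∧ ∀ x, φ x ≤ M ‖x‖

/-- `φ_t (x) = t^{-n} φ (x / t)`. -/
noncomputable def dilate {n : ℕ} (φ : Rn n → ℝ) (t : ℝ) (x : Rn n) : ℝ :=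
  (t ^ n)⁻¹ * φ (t⁻¹ • x)

/-- The function `u (x, t) = (f ∗ φ_t) (x)` on the half-space. -/
noncomputable def convExt {𝕜 : Type*} [RCLike 𝕜] {n : ℕ} (φ : Rn n → ℝ) (f : Rn n → 𝕜)
    (p : HalfSpace n) : 𝕜 :=
  convolution f (dilate φ p.2) (ContinuousLinearMap.lsmul ℝ ℝ).flip volume p.1

/-- The estimate `‖f ∗ φ_t‖ ≤ C ‖f‖_{L^{r,q}}`, uniformly in `f ∈ L^{r,q}`, the norm on the left
being that of `Λ^q_μ ((Ψ⁻¹)^{n/r})`. -/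
def ConvEstimate (𝕜 : Type*) [RCLike 𝕜] {n : ℕ} (μ : Measure (HalfSpace n)) (φ : Rn n → ℝ)
    (Ψ : ℝ≥0 → ℝ≥0) (r : ℝ) (q : ℝ≥0∞) : Prop :=
  ∃ C : ℝ≥0, ∀ f : Rn n → 𝕜, MemLorentz f r q →
    weightedLorentzNorm μ Ψ (n / r) q (convExt φ f) ≤ C * lorentzNorm f r q

/-! Direct part. Fix a level `lam` and keep only the part G of ‖f‖ above it. The rest contributes at
most `lam * ∫ φ` to f ∗ φ_t, so where |f ∗ φ_t| > (∫ φ + 1) `lam` the kernel average of G exceeds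
`lam`. By non-tangential domination (`lintegral_dilate_le_maximalFn`) the maximal function of G is
then at least a constant times `lam` on the whole ball B(x, 2t). The union O of these balls is open,
its tent contains the superlevel set, and the weak (1,1) inequality with a dyadic decomposition of G
gives |O| ≤ C Σ 2^k |{‖f‖ > 2^k `lam`}| (`exists_tent_cover`).

A tent bound μ(TO) ≤ Ψ(a |O|^{1/n}) turns this into a pointwise bound of Ψ⁻¹(h)^{n/r} by the 1/r-th
power of that sum, and the Hardy inequality `lorentzFunctional_tsum_le` returns to ‖f‖. Here r > 1
enters: dilating the level by 2^k gains 2^{-k}, while the weight costs only 2^{k/r}. The constant in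
the definition of V^Φ goes into K or, when Φ grows, into the dilation a.

Converse. Test on f = 1_O. If (x, t) lies in TO, then B(x, t) ⊆ O, so f ∗ φ_t is at least the mass
of φ on the unit ball. The weak form of the estimate gives Ψ⁻¹(μ(TO)) ≤ c |O|^{1/n}, and the
dilation property of Φ absorbs c. -/

/-! ### The maximal function and its weak type inequality -/

/-- The centred Hardy–Littlewood maximal function (normalized by `r ^ n`, not by the volume). -/
noncomputable def maximalFn {n : ℕ} (G : Rn n → ℝ≥0∞) (x : Rn n) : ℝ≥0∞ :=
  ⨆ (r : ℝ) (_ : 0 < r), (ENNReal.ofReal r ^ n)⁻¹ * ∫⁻ z in Metric.closedBall x r, G z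

theorem volume_closedBall_Rn {n : ℕ} (x : Rn n) {r : ℝ} (hr : 0 ≤ r) :
    volume (Metric.closedBall x r) =
      ENNReal.ofReal r ^ n * volume (Metric.ball (0 : Rn n) 1) := by
  rw [Measure.addHaar_closedBall volume x hr, finrank_euclideanSpace_fin, ENNReal.ofReal_pow hr]

theorem setLIntegral_closedBall_le_maximalFn {n : ℕ} (G : Rn n → ℝ≥0∞) (x : Rn n) {r : ℝ}
    (hr : 0 < r) :
    ∫⁻ z in Metric.closedBall x r, G z ≤ ENNReal.ofReal r ^ n * maximalFn G x := by
  have h0 : ENNReal.ofReal r ^ n ≠ 0 := pow_ne_zero _ (by simpa using hr)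
  have h1 : ENNReal.ofReal r ^ n ≠ ∞ := ENNReal.pow_ne_top ENNReal.ofReal_ne_top
  calc ∫⁻ z in Metric.closedBall x r, G z
      = ENNReal.ofReal r ^ n * ((ENNReal.ofReal r ^ n)⁻¹ *
          ∫⁻ z in Metric.closedBall x r, G z) := by
        rw [← mul_assoc, ENNReal.mul_inv_cancel h0 h1, one_mul]
    _ ≤ _ := by
        gcongr
        exact le_iSup₂ (f := fun (r : ℝ) (_ : 0 < r) =>
          (ENNReal.ofReal r ^ n)⁻¹ * ∫⁻ z in Metric.closedBall x r, G z) r hr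

/-- The weak type `(1, 1)` inequality for the maximal function. -/
theorem volume_lt_maximalFn_le {n : ℕ} (hn : 0 < n) {G : Rn n → ℝ≥0∞}
    (hG : ∫⁻ z, G z ≠ ∞) {a : ℝ≥0∞} (ha : a ≠ 0) (ha' : a ≠ ∞) :
    volume {x | a < maximalFn G x} ≤
      5 ^ n * volume (Metric.ball (0 : Rn n) 1) * a⁻¹ * ∫⁻ z, G z := by
  set S := {x | a < maximalFn G x}
  have hex : ∀ x : Rn n, x ∈ S → ∃ r : ℝ, 0 < r ∧
      a * ENNReal.ofReal r ^ n ≤ ∫⁻ z in Metric.closedBall x r, G z := by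
    intro x hx
    obtain ⟨r, hr⟩ := lt_iSup_iff.1 (show a < maximalFn G x from hx)
    obtain ⟨hr0, hr⟩ := lt_iSup_iff.1 hr
    refine ⟨r, hr0, ?_⟩
    have h0 : ENNReal.ofReal r ^ n ≠ 0 := pow_ne_zero _ (by simpa using hr0)
    have h1 : ENNReal.ofReal r ^ n ≠ ∞ := ENNReal.pow_ne_top ENNReal.ofReal_ne_top
    rw [← ENNReal.div_eq_inv_mul] at hr
    exact (ENNReal.le_div_iff_mul_le (Or.inl h0) (Or.inl h1)).1 hr.le
  choose! ρ hρ0 hρ using hex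
  -- Vitali's lemma needs bounded radii. Since `a * ρ ^ n` is at most the total mass of `G`, they
  -- are; the case `ρ ≤ 1` is split off because `ρ ≤ ρ ^ n` needs `1 ≤ ρ`.
  have hbdd : ∃ R : ℝ, ∀ x ∈ S, ρ x ≤ R := by
    refine ⟨max 1 ((a⁻¹ * ∫⁻ z, G z).toReal), fun x hx => ?_⟩
    have h1 : ENNReal.ofReal (ρ x) ^ n ≤ a⁻¹ * ∫⁻ z, G z := by
      rw [← ENNReal.div_eq_inv_mul, ENNReal.le_div_iff_mul_le (Or.inl ha) (Or.inl ha'), mul_comm]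
      exact (hρ x hx).trans (setLIntegral_le_lintegral _ _)
    rcases le_total (ρ x) 1 with h | h
    · exact le_max_of_le_left h
    · apply le_max_of_le_right
      rw [← ENNReal.ofReal_le_iff_le_toReal (ENNReal.mul_ne_top (ENNReal.inv_ne_top.2 ha) hG)]
      refine le_trans ?_ h1
      exact le_self_pow (by simpa using h) hn.ne'
  obtain ⟨R, hR⟩ := hbdd
  obtain ⟨u, huS, hdisj, hcov⟩ := Vitali.exists_disjoint_subfamily_covering_enlargement_closedBall
    S (fun x => x) ρ R hR 5 (by norm_num)
  have hcount : u.Countable := hdisj.countable_of_nonempty_interior fun x hx =>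
    ⟨x, Metric.ball_subset_interior_closedBall (Metric.mem_ball_self (hρ0 x (huS hx)))⟩
  have hsub : S ⊆ ⋃ b ∈ u, Metric.closedBall b (5 * ρ b) := by
    intro x hx
    obtain ⟨b, hb, hxb⟩ := hcov x hx
    exact mem_iUnion₂.2 ⟨b, hb, hxb (Metric.mem_closedBall_self (hρ0 x hx).le)⟩
  have hball : ∀ b : u, volume (Metric.closedBall (b : Rn n) (5 * ρ b)) ≤
      5 ^ n * volume (Metric.ball (0 : Rn n) 1) * a⁻¹ *
        ∫⁻ z in Metric.closedBall (b : Rn n) (ρ b), G z := by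
    intro b
    have hb := huS b.2
    have h1 : ENNReal.ofReal (ρ b) ^ n ≤ a⁻¹ * ∫⁻ z in Metric.closedBall (b : Rn n) (ρ b), G z := by
      rw [← ENNReal.div_eq_inv_mul, ENNReal.le_div_iff_mul_le (Or.inl ha) (Or.inl ha'), mul_comm]
      exact hρ b hb
    rw [volume_closedBall_Rn _ (by have := hρ0 b hb; positivity),
      ENNReal.ofReal_mul (by norm_num), mul_pow, ENNReal.ofReal_ofNat]
    calc _ = 5 ^ n * volume (Metric.ball (0 : Rn n) 1) * ENNReal.ofReal (ρ b) ^ n := by ring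
      _ ≤ 5 ^ n * volume (Metric.ball (0 : Rn n) 1) *
          (a⁻¹ * ∫⁻ z in Metric.closedBall (b : Rn n) (ρ b), G z) := by gcongr
      _ = _ := by ring
  calc volume S ≤ volume (⋃ b ∈ u, Metric.closedBall b (5 * ρ b)) := measure_mono hsub
    _ ≤ ∑' b : u, volume (Metric.closedBall (b : Rn n) (5 * ρ b)) :=
        measure_biUnion_le _ hcount _
    _ ≤ ∑' b : u, 5 ^ n * volume (Metric.ball (0 : Rn n) 1) * a⁻¹ *
          ∫⁻ z in Metric.closedBall (b : Rn n) (ρ b), G z := ENNReal.tsum_le_tsum hball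
    _ = 5 ^ n * volume (Metric.ball (0 : Rn n) 1) * a⁻¹ *
          ∫⁻ z in ⋃ b ∈ u, Metric.closedBall b (ρ b), G z := by
        rw [ENNReal.tsum_mul_left, lintegral_biUnion hcount
          (fun _ _ => Metric.isClosed_closedBall.measurableSet) hdisj]
    _ ≤ _ := by gcongr; exact Measure.restrict_le_self

/-! ### Non-tangential domination of kernel averages -/

/-- The dyadic sum attached to an integrable radially decreasing function converges. -/
theorem tsum_majorant_ne_top {n : ℕ} (hn : 0 < n) {M : ℝ → ℝ} (hM : AntitoneOn M (Ici 0))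
    (hint : Integrable (fun x : Rn n => M ‖x‖) volume) :
    ∑' j : ℕ, ENNReal.ofReal (M (2 ^ (j + 1))) * ENNReal.ofReal (2 ^ (j + 3)) ^ n ≠ ∞ := by
  have : Nonempty (Fin n) := ⟨⟨0, hn⟩⟩
  set ω := volume (Metric.ball (0 : Rn n) 1)
  have hω : ω ≠ 0 := (Metric.measure_ball_pos volume _ one_pos).ne'
  have hω' : ω ≠ ∞ := measure_ball_lt_top.ne
  set s : ℕ → Set (Rn n) := fun j => Metric.ball 0 (2 ^ (j + 1)) \ Metric.ball 0 (2 ^ j)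
  have hs : ∀ j, volume (s j) = (ENNReal.ofReal (2 ^ (j + 1)) ^ n - ENNReal.ofReal (2 ^ j) ^ n) * ω := by
    intro j
    rw [measure_sdiff (Metric.ball_subset_ball (by gcongr <;> norm_num))
      Metric.isOpen_ball.nullMeasurableSet measure_ball_lt_top.ne,
      Measure.addHaar_ball volume _ (r := 2 ^ (j + 1)) (by positivity),
      Measure.addHaar_ball volume _ (r := 2 ^ j) (by positivity),
      finrank_euclideanSpace_fin, ENNReal.sub_mul (fun _ _ => hω'),
      ← ENNReal.ofReal_pow (p := 2 ^ (j + 1)) (by positivity),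
      ← ENNReal.ofReal_pow (p := 2 ^ j) (by positivity)]
  -- As n ≥ 1, doubling the radius at least doubles the volume, so each dyadic annulus is at least
  -- as large as its inner ball.
  have hs' : ∀ j, ENNReal.ofReal (2 ^ j) ^ n * ω ≤ volume (s j) := by
    intro j
    rw [hs]
    gcongr
    apply ENNReal.le_sub_of_add_le_left (ENNReal.pow_ne_top ENNReal.ofReal_ne_top)
    rw [pow_succ (2 : ℝ), ENNReal.ofReal_mul (by positivity), mul_pow, ENNReal.ofReal_ofNat,
      ← mul_two]
    gcongr
    exact le_self_pow (by norm_num) hn.ne'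
  have hdisj : Pairwise (Function.onFun Disjoint s) := by
    have key : ∀ i j, i < j → Disjoint (s i) (s j) := by
      intro i j hij
      rw [Set.disjoint_left]
      rintro x ⟨h1, -⟩ ⟨-, h2⟩
      exact h2 (Metric.ball_subset_ball (pow_le_pow_right₀ (by norm_num) hij) h1)
    intro i j hij
    rcases lt_or_gt_of_ne hij with h | h
    · exact key i j h
    · exact (key j i h).symm
  have hlow : ∀ j : ℕ, ENNReal.ofReal (M (2 ^ (j + 1))) * volume (s j) ≤
      ∫⁻ x in s j, ENNReal.ofReal (M ‖x‖) := by
    intro j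
    rw [← setLIntegral_const]
    refine setLIntegral_mono' (Metric.isOpen_ball.measurableSet.diff
      Metric.isOpen_ball.measurableSet) fun x hx => ?_
    apply ENNReal.ofReal_le_ofReal
    have : ‖x‖ < 2 ^ (j + 1) := by simpa using hx.1
    exact hM (norm_nonneg _) (by simp only [mem_Ici]; positivity) this.le
  have htot : ∑' j : ℕ, ENNReal.ofReal (M (2 ^ (j + 1))) * volume (s j) ≠ ∞ := by
    refine ne_top_of_le_ne_top ?_ (ENNReal.tsum_le_tsum hlow)
    rw [← lintegral_iUnion (fun j => Metric.isOpen_ball.measurableSet.diff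
      Metric.isOpen_ball.measurableSet) hdisj]
    refine ne_top_of_le_ne_top ?_ (setLIntegral_le_lintegral _ _)
    exact (hint.lintegral_lt_top).ne
  refine ne_top_of_le_ne_top (ENNReal.mul_ne_top (a := 8 ^ n * ω⁻¹) (b := _)
    (ENNReal.mul_ne_top (by simp) (ENNReal.inv_ne_top.2 hω)) htot) ?_
  rw [← ENNReal.tsum_mul_left]
  refine ENNReal.tsum_le_tsum fun j => ?_
  calc ENNReal.ofReal (M (2 ^ (j + 1))) * ENNReal.ofReal (2 ^ (j + 3)) ^ n
      = 8 ^ n * (ω⁻¹ * ω) * (ENNReal.ofReal (M (2 ^ (j + 1))) * ENNReal.ofReal (2 ^ j) ^ n) := by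
        rw [ENNReal.inv_mul_cancel hω hω', pow_add (2 : ℝ) j 3, ENNReal.ofReal_mul (by positivity),
          mul_pow]
        norm_num
        ring
    _ = 8 ^ n * ω⁻¹ * (ENNReal.ofReal (M (2 ^ (j + 1))) * (ENNReal.ofReal (2 ^ j) ^ n * ω)) := by
        ring
    _ ≤ _ := by gcongr; exact hs' j

/-- Averages against dilates of a kernel are dominated, non-tangentially, by the maximal
function. -/
theorem lintegral_dilate_le_maximalFn {n : ℕ} (hn : 0 < n) {φ : Rn n → ℝ} (hφ : IsKernel φ) :
    ∃ A : ℝ≥0∞, A ≠ ∞ ∧ ∀ G : Rn n → ℝ≥0∞, AEMeasurable G volume → ∀ (x y : Rn n) (t : ℝ),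
      0 < t → dist x y < 2 * t →
      ∫⁻ z, G z * ENNReal.ofReal (dilate φ t (y - z)) ≤ A * maximalFn G x := by
  obtain ⟨M, hM, -, hint, hφM⟩ := hφ.majorant
  set c : ℕ → ℝ≥0∞ := fun j => ENNReal.ofReal (M (2 ^ (j + 1)))
  refine ⟨ENNReal.ofReal (M 0) * ENNReal.ofReal 4 ^ n +
    ∑' j : ℕ, c j * ENNReal.ofReal (2 ^ (j + 3)) ^ n,
    ENNReal.add_ne_top.2 ⟨ENNReal.mul_ne_top ENNReal.ofReal_ne_top
      (ENNReal.pow_ne_top ENNReal.ofReal_ne_top), tsum_majorant_ne_top hn hM hint⟩, ?_⟩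
  intro G hG x y t ht hxy
  set T : ℝ≥0∞ := ENNReal.ofReal (t ^ n)⁻¹ 
  have hT : T * ENNReal.ofReal t ^ n = 1 := by
    rw [← ENNReal.ofReal_pow ht.le, ← ENNReal.ofReal_mul (by positivity),
      inv_mul_cancel₀ (by positivity), ENNReal.ofReal_one]
  -- Near `x` the majorant is at most `M 0`. Otherwise 2^j · 4t ≤ |x - z| < 2^(j+1) · 4t for some j
  -- ≥ 0, and |x - y| < 2t leaves |y - z| ≥ 2^(j+1) t; this explains the shifts j + 1 in `M` and j +
  -- 3 in the radius.
  have hpt : ∀ z, G z * ENNReal.ofReal (dilate φ t (y - z)) ≤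
      T * ENNReal.ofReal (M 0) * (Metric.closedBall x (4 * t)).indicator G z +
      ∑' j : ℕ, T * c j * (Metric.closedBall x (2 ^ (j + 3) * t)).indicator G z := by
    intro z
    have hd : ENNReal.ofReal (dilate φ t (y - z)) ≤
        T * ENNReal.ofReal (M (‖y - z‖ / t)) := by
      rw [← ENNReal.ofReal_mul (by positivity)]
      apply ENNReal.ofReal_le_ofReal
      unfold dilate
      gcongr
      refine (hφM _).trans (le_of_eq ?_)
      rw [norm_smul, norm_inv, Real.norm_of_nonneg ht.le, div_eq_inv_mul]
    have htri : ‖x - z‖ ≤ 2 * t + ‖y - z‖ := by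
      have := dist_triangle x y z
      rw [dist_eq_norm x z, dist_eq_norm y z] at this
      linarith
    by_cases hz : z ∈ Metric.closedBall x (4 * t)
    · refine le_add_right ?_
      rw [indicator_of_mem hz, mul_comm]
      gcongr
      refine hd.trans ?_
      gcongr
      exact hM (by simp) (by simp only [mem_Ici]; positivity) (by positivity)
    · refine le_add_left ?_
      have hz' : 4 * t < ‖x - z‖ := by
        simpa [dist_eq_norm, norm_sub_rev] using hz
      have h1 : 1 ≤ ‖x - z‖ / (4 * t) := by
        rw [le_div_iff₀ (by positivity)]; linarith
      obtain ⟨j, hj1, hj2⟩ := exists_nat_pow_near h1 (by norm_num : (1 : ℝ) < 2)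
      rw [le_div_iff₀ (by positivity)] at hj1
      rw [div_lt_iff₀ (by positivity)] at hj2
      refine le_trans ?_ (ENNReal.le_tsum j)
      have hzj : z ∈ Metric.closedBall x (2 ^ (j + 3) * t) := by
        rw [mem_closedBall_iff_norm, norm_sub_rev]
        calc ‖x - z‖ ≤ 2 ^ (j + 1) * (4 * t) := hj2.le
          _ = _ := by ring
      rw [indicator_of_mem hzj, mul_comm]
      gcongr
      refine hd.trans ?_
      gcongr
      refine ENNReal.ofReal_le_ofReal (hM (by simp only [mem_Ici]; positivity)
        (by simp only [mem_Ici]; positivity) ?_)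
      rw [le_div_iff₀ ht]
      have : (1 : ℝ) ≤ 2 ^ j := one_le_pow₀ (by norm_num)
      have h2 : t ≤ 2 ^ j * t := le_mul_of_one_le_left ht.le this
      rw [pow_succ]
      linarith
  have hball : ∀ (b : ℝ≥0∞) (ρ : ℝ), 0 < ρ →
      ∫⁻ z, T * b * (Metric.closedBall x (ρ * t)).indicator G z ≤
        b * ENNReal.ofReal ρ ^ n * maximalFn G x := by
    intro b ρ hρ
    rw [lintegral_const_mul'' _ (hG.indicator Metric.isClosed_closedBall.measurableSet),
      lintegral_indicator Metric.isClosed_closedBall.measurableSet]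
    calc _ ≤ T * b * (ENNReal.ofReal (ρ * t) ^ n * maximalFn G x) := by
          gcongr; exact setLIntegral_closedBall_le_maximalFn G x (by positivity)
      _ = b * ENNReal.ofReal ρ ^ n * maximalFn G x * (T * ENNReal.ofReal t ^ n) := by
          rw [ENNReal.ofReal_mul hρ.le]; ring
      _ = _ := by rw [hT, mul_one]
  have hmeas : ∀ (b : ℝ≥0∞) (ρ : ℝ), AEMeasurable
      (fun z => b * (Metric.closedBall x ρ).indicator G z) volume := fun b ρ =>
    (hG.indicator Metric.isClosed_closedBall.measurableSet).const_mul b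
  calc ∫⁻ z, G z * ENNReal.ofReal (dilate φ t (y - z))
      ≤ ∫⁻ z, (T * ENNReal.ofReal (M 0) * (Metric.closedBall x (4 * t)).indicator G z +
          ∑' j : ℕ, T * c j * (Metric.closedBall x (2 ^ (j + 3) * t)).indicator G z) :=
        lintegral_mono hpt
    _ = (∫⁻ z, T * ENNReal.ofReal (M 0) * (Metric.closedBall x (4 * t)).indicator G z) +
          ∑' j : ℕ, ∫⁻ z, T * c j * (Metric.closedBall x (2 ^ (j + 3) * t)).indicator G z := by
        rw [lintegral_add_left' (hmeas _ _), lintegral_tsum fun j => hmeas _ _]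
    _ ≤ ENNReal.ofReal (M 0) * ENNReal.ofReal 4 ^ n * maximalFn G x +
          ∑' j : ℕ, c j * ENNReal.ofReal (2 ^ (j + 3)) ^ n * maximalFn G x := by
        gcongr
        · exact hball _ _ (by norm_num)
        · exact hball _ _ (by positivity)
    _ = _ := by rw [ENNReal.tsum_mul_right, add_mul]

/-! ### The Lorentz functional: scaling, weak bound, Hardy inequality -/

theorem lorentzFunctional_top (D : ℝ → ℝ≥0∞) :
    lorentzFunctional D ∞ = ⨆ (lam : ℝ) (_ : 0 < lam), ENNReal.ofReal lam * D lam :=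
  if_pos rfl

theorem lorentzFunctional_of_ne_top (D : ℝ → ℝ≥0∞) {q : ℝ≥0∞} (hq : q ≠ ∞) :
    lorentzFunctional D q = (∫⁻ lam in Ioi (0 : ℝ),
      D lam ^ q.toReal * ENNReal.ofReal (q.toReal * lam ^ (q.toReal - 1))) ^ (1 / q.toReal) :=
  if_neg hq

theorem lorentzFunctional_mono {D E : ℝ → ℝ≥0∞} (h : ∀ lam, 0 < lam → D lam ≤ E lam) (q : ℝ≥0∞) :
    lorentzFunctional D q ≤ lorentzFunctional E q := by
  by_cases hq : q = ∞
  · subst hq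
    rw [lorentzFunctional_top, lorentzFunctional_top]
    exact iSup₂_mono fun lam hlam => by gcongr; exact h lam hlam
  · rw [lorentzFunctional_of_ne_top _ hq, lorentzFunctional_of_ne_top _ hq]
    refine ENNReal.rpow_le_rpow (setLIntegral_mono' measurableSet_Ioi fun lam hlam => ?_)
      (by positivity)
    gcongr
    exact h lam hlam

theorem lorentzFunctional_const_mul {D : ℝ → ℝ≥0∞} {c : ℝ≥0∞} (hc : c ≠ ∞) {q : ℝ≥0∞}
    (hq : 0 < q) :
    lorentzFunctional (fun lam => c * D lam) q = c * lorentzFunctional D q := by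
  by_cases hq' : q = ∞
  · subst hq'
    simp_rw [lorentzFunctional_top, ENNReal.mul_iSup]
    exact iSup_congr fun lam => iSup_congr fun _ => mul_left_comm _ _ _
  · have hp : 0 < q.toReal := ENNReal.toReal_pos hq.ne' hq'
    rw [lorentzFunctional_of_ne_top _ hq', lorentzFunctional_of_ne_top _ hq']
    simp_rw [ENNReal.mul_rpow_of_nonneg _ _ hp.le, mul_assoc]
    rw [lintegral_const_mul' _ _ (ENNReal.rpow_ne_top_of_nonneg hp.le hc),
      ENNReal.mul_rpow_of_nonneg _ _ (by positivity), ← ENNReal.rpow_mul, mul_one_div_cancel hp.ne',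
      ENNReal.rpow_one]

/-- Change of variables in the integral of d(lam^q). One inequality is enough, since applying it to
`c⁻¹` gives the reverse one. -/
theorem lorentzFunctional_comp_mul_le (D : ℝ → ℝ≥0∞) {c : ℝ} (hc : 0 < c) {q : ℝ≥0∞}
    (hq : 0 < q) :
    lorentzFunctional (fun lam => D (c * lam)) q ≤ ENNReal.ofReal c⁻¹ * lorentzFunctional D q := by
  by_cases hq' : q = ∞
  · subst hq'
    simp_rw [lorentzFunctional_top, ENNReal.mul_iSup]
    refine iSup₂_le fun lam hlam => ?_
    refine le_trans (le_of_eq ?_) (le_iSup₂ (f := fun (lam : ℝ) (_ : 0 < lam) =>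
      ENNReal.ofReal c⁻¹ * (ENNReal.ofReal lam * D lam)) (c * lam) (by positivity))
    rw [← mul_assoc, ← ENNReal.ofReal_mul (by positivity), inv_mul_cancel_left₀ hc.ne']
  · have hp : 0 < q.toReal := ENNReal.toReal_pos hq.ne' hq'
    rw [lorentzFunctional_of_ne_top _ hq', lorentzFunctional_of_ne_top _ hq']
    set p := q.toReal
    have himg : (fun lam : ℝ => c * lam) '' Ioi 0 = Ioi 0 := by
      rw [Set.image_mul_left_Ioi hc, mul_zero]
    have hcv := lintegral_image_eq_lintegral_abs_deriv_mul (s := Ioi (0 : ℝ))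
      (f := fun lam => c * lam) (f' := fun _ => c) measurableSet_Ioi
      (fun x _ => by simpa using ((hasDerivAt_id x).const_mul c).hasDerivWithinAt)
      (fun x _ y _ h => mul_left_cancel₀ hc.ne' h)
      (fun lam => D lam ^ p * ENNReal.ofReal (p * lam ^ (p - 1)))
    rw [himg] at hcv
    have hcp : ENNReal.ofReal c⁻¹ = (ENNReal.ofReal (c⁻¹ ^ p)) ^ (1 / p) := by
      rw [ENNReal.ofReal_rpow_of_nonneg (by positivity) (by positivity),
        ← Real.rpow_mul (by positivity), mul_one_div_cancel hp.ne', Real.rpow_one]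
    rw [hcv, hcp, ← ENNReal.mul_rpow_of_nonneg _ _ (by positivity),
      ← lintegral_const_mul' _ _ ENNReal.ofReal_ne_top]
    refine le_of_eq ?_
    congr 1
    refine setLIntegral_congr_fun measurableSet_Ioi fun lam hlam => ?_
    have hlam' : 0 < lam := hlam
    rw [show ENNReal.ofReal (c⁻¹ ^ p) * (ENNReal.ofReal |c| *
        (D (c * lam) ^ p * ENNReal.ofReal (p * (c * lam) ^ (p - 1)))) = D (c * lam) ^ p *
        (ENNReal.ofReal (c⁻¹ ^ p) * (ENNReal.ofReal |c| *
          ENNReal.ofReal (p * (c * lam) ^ (p - 1)))) by ring,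
      ← ENNReal.ofReal_mul (by positivity), ← ENNReal.ofReal_mul (by positivity)]
    congr 2
    rw [abs_of_pos hc, Real.mul_rpow hc.le hlam'.le, Real.rpow_sub_one hc.ne',
      Real.inv_rpow hc.le]
    have : c ^ p ≠ 0 := (Real.rpow_pos_of_pos hc p).ne'
    field_simp

theorem lorentzFunctional_le_comp_mul (D : ℝ → ℝ≥0∞) {c : ℝ} (hc : 0 < c) {q : ℝ≥0∞}
    (hq : 0 < q) :
    lorentzFunctional D q ≤ ENNReal.ofReal c * lorentzFunctional (fun lam => D (c * lam)) q := by
  have := lorentzFunctional_comp_mul_le (fun lam => D (c * lam)) (inv_pos.2 hc) hq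
  simpa [mul_inv_cancel_left₀ hc.ne'] using this

theorem lintegral_Ioc_mul_rpow {p : ℝ} (hp : 0 < p) {a : ℝ} (ha : 0 ≤ a) :
    ∫⁻ s in Ioc 0 a, ENNReal.ofReal (p * s ^ (p - 1)) = ENNReal.ofReal (a ^ p) := by
  have hint : IntervalIntegrable (fun s : ℝ => p * s ^ (p - 1)) volume 0 a :=
    (intervalIntegral.intervalIntegrable_rpow' (by linarith)).const_mul p
  rw [← ofReal_integral_eq_lintegral_ofReal
    ((intervalIntegrable_iff_integrableOn_Ioc_of_le ha).1 hint)
    ((ae_restrict_iff' measurableSet_Ioc).2 (Filter.Eventually.of_forall fun s hs => by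
      have := hs.1; simp only [Pi.zero_apply]; positivity)),
    ← intervalIntegral.integral_of_le ha, intervalIntegral.integral_const_mul,
    integral_rpow (Or.inl (by linarith))]
  congr 1
  rw [sub_add_cancel, Real.zero_rpow hp.ne', sub_zero]
  field_simp

/-- The Lorentz functional dominates its weak counterpart. -/
theorem mul_le_lorentzFunctional {D : ℝ → ℝ≥0∞} (hD : Antitone D) {q : ℝ≥0∞} (hq : 0 < q)
    {lam : ℝ} (hlam : 0 < lam) : ENNReal.ofReal lam * D lam ≤ lorentzFunctional D q := by
  by_cases hq' : q = ∞
  · subst hq'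
    rw [lorentzFunctional_top]
    exact le_iSup₂ (f := fun (lam : ℝ) (_ : 0 < lam) => ENNReal.ofReal lam * D lam) lam hlam
  · have hp : 0 < q.toReal := ENNReal.toReal_pos hq.ne' hq'
    rw [lorentzFunctional_of_ne_top _ hq']
    set p := q.toReal
    calc ENNReal.ofReal lam * D lam = (D lam ^ p * ENNReal.ofReal (lam ^ p)) ^ (1 / p) := by
          rw [← ENNReal.ofReal_rpow_of_pos hlam, ← ENNReal.mul_rpow_of_nonneg _ _ hp.le,
            ← ENNReal.rpow_mul, mul_one_div_cancel hp.ne', ENNReal.rpow_one, mul_comm]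
      _ ≤ _ := by
          refine ENNReal.rpow_le_rpow ?_ (by positivity)
          rw [← lintegral_Ioc_mul_rpow hp hlam.le, ← lintegral_const_mul _ (by fun_prop)]
          refine le_trans ?_ (lintegral_mono_set (Ioc_subset_Ioi_self (a := lam) (b := (0 : ℝ))))
          refine setLIntegral_mono' measurableSet_Ioc fun s hs => ?_
          gcongr
          exact hD hs.2

/-- The Lorentz functional of a function supported in `(0, 1)`. -/
theorem lorentzFunctional_le_of_support {D : ℝ → ℝ≥0∞} {a : ℝ≥0∞} (h1 : ∀ lam, 0 < lam → D lam ≤ a)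
    (h2 : ∀ lam, 1 ≤ lam → D lam = 0) {q : ℝ≥0∞} (hq : 0 < q) : lorentzFunctional D q ≤ a := by
  by_cases hq' : q = ∞
  · subst hq'
    rw [lorentzFunctional_top]
    refine iSup₂_le fun lam hlam => ?_
    rcases le_total 1 lam with h | h
    · simp [h2 lam h]
    · calc ENNReal.ofReal lam * D lam ≤ 1 * a := by
            gcongr
            · simpa using h
            · exact h1 lam hlam
        _ = a := one_mul a
  · have hp : 0 < q.toReal := ENNReal.toReal_pos hq.ne' hq'
    rw [lorentzFunctional_of_ne_top _ hq']
    set p := q.toReal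
    have : ∫⁻ lam in Ioi (0 : ℝ), D lam ^ p * ENNReal.ofReal (p * lam ^ (p - 1)) ≤ a ^ p := by
      have hle := lintegral_Ioc_mul_rpow hp zero_le_one
      calc _ ≤ ∫⁻ lam in Ioi (0 : ℝ), (Ioc (0 : ℝ) 1).indicator
              (fun lam => a ^ p * ENNReal.ofReal (p * lam ^ (p - 1))) lam := by
            refine setLIntegral_mono' measurableSet_Ioi fun lam hlam => ?_
            rcases le_or_gt lam 1 with h | h
            · rw [indicator_of_mem (show lam ∈ Ioc (0 : ℝ) 1 from ⟨hlam, h⟩)]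
              gcongr
              exact h1 lam hlam
            · rw [h2 lam h.le, ENNReal.zero_rpow_of_pos hp, zero_mul]
              exact zero_le
        _ ≤ ∫⁻ lam in Ioc (0 : ℝ) 1, a ^ p * ENNReal.ofReal (p * lam ^ (p - 1)) := by
            rw [← lintegral_indicator measurableSet_Ioc]
            exact setLIntegral_le_lintegral _ _
        _ = a ^ p := by
            rw [lintegral_const_mul _ (by fun_prop), hle]
            simp
    calc _ ≤ (a ^ p) ^ (1 / p) := ENNReal.rpow_le_rpow this (by positivity)
      _ = a := by rw [← ENNReal.rpow_mul, mul_one_div_cancel hp.ne', ENNReal.rpow_one]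

/-- A supremum of functions whose Lorentz functionals decay geometrically. -/
theorem lorentzFunctional_iSup_le {θ : ℝ≥0∞} (hθ : θ < 1) {q : ℝ≥0∞} (hq : 0 < q) :
    ∃ C : ℝ≥0∞, C ≠ ∞ ∧ ∀ (D : ℕ → ℝ → ℝ≥0∞) (N : ℝ≥0∞), (∀ k, Measurable (D k)) →
      (∀ k, lorentzFunctional (D k) q ≤ θ ^ k * N) →
      lorentzFunctional (fun lam => ⨆ k, D k lam) q ≤ C * N := by
  by_cases hq' : q = ∞
  · subst hq'
    refine ⟨1, by simp, fun D N _ h => ?_⟩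
    rw [lorentzFunctional_top]
    refine iSup₂_le fun lam hlam => ?_
    rw [ENNReal.mul_iSup]
    refine iSup_le fun k => ?_
    calc _ ≤ lorentzFunctional (D k) ∞ := by
          rw [lorentzFunctional_top]
          exact le_iSup₂ (f := fun (lam : ℝ) (_ : 0 < lam) => ENNReal.ofReal lam * D k lam) lam hlam
      _ ≤ θ ^ k * N := h k
      _ ≤ 1 * N := by gcongr; exact pow_le_one₀ zero_le hθ.le
  · have hp : 0 < q.toReal := ENNReal.toReal_pos hq.ne' hq'
    set p := q.toReal with hpdef
    have hθp : θ ^ p < 1 := ENNReal.rpow_lt_one hθ hp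
    refine ⟨((1 - θ ^ p)⁻¹) ^ (1 / p), ENNReal.rpow_ne_top_of_nonneg (by positivity)
      (ENNReal.inv_ne_top.2 (tsub_pos_of_lt hθp).ne'), fun D N hD h => ?_⟩
    rw [lorentzFunctional_of_ne_top _ hq', ← hpdef]
    have hk : ∀ k, ∫⁻ lam in Ioi (0 : ℝ), D k lam ^ p * ENNReal.ofReal (p * lam ^ (p - 1)) ≤
        (θ ^ p) ^ k * N ^ p := by
      intro k
      have := ENNReal.rpow_le_rpow (h k) hp.le
      rw [lorentzFunctional_of_ne_top _ hq', ← hpdef, ← ENNReal.rpow_mul,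
        one_div_mul_cancel hp.ne', ENNReal.rpow_one, ENNReal.mul_rpow_of_nonneg _ _ hp.le] at this
      refine this.trans (le_of_eq ?_)
      rw [← ENNReal.rpow_natCast, ← ENNReal.rpow_natCast, ← ENNReal.rpow_mul, ← ENNReal.rpow_mul,
        mul_comm p]
    -- The p-th power of a supremum is at most the sum of the p-th powers. No triangle inequality is
    -- used, so p < 1 is allowed.
    have hsum : ∫⁻ lam in Ioi (0 : ℝ), (⨆ k, D k lam) ^ p * ENNReal.ofReal (p * lam ^ (p - 1)) ≤
        (1 - θ ^ p)⁻¹ * N ^ p := by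
      calc _ ≤ ∫⁻ lam in Ioi (0 : ℝ), ∑' k, D k lam ^ p * ENNReal.ofReal (p * lam ^ (p - 1)) := by
            refine lintegral_mono fun lam => ?_
            simp only
            rw [ENNReal.tsum_mul_right]
            gcongr
            rw [← ENNReal.le_rpow_inv_iff hp]
            refine iSup_le fun k => ?_
            rw [ENNReal.le_rpow_inv_iff hp]
            exact ENNReal.le_tsum (f := fun k => D k lam ^ p) k
        _ = ∑' k, ∫⁻ lam in Ioi (0 : ℝ), D k lam ^ p * ENNReal.ofReal (p * lam ^ (p - 1)) :=
            lintegral_tsum fun k => (((hD k).pow_const p).mul (by fun_prop)).aemeasurable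
        _ ≤ ∑' k, (θ ^ p) ^ k * N ^ p := ENNReal.tsum_le_tsum hk
        _ = _ := by rw [ENNReal.tsum_mul_right, ENNReal.tsum_geometric]
    calc _ ≤ ((1 - θ ^ p)⁻¹ * N ^ p) ^ (1 / p) := ENNReal.rpow_le_rpow hsum (by positivity)
      _ = _ := by
        rw [ENNReal.mul_rpow_of_nonneg _ _ (by positivity), ← ENNReal.rpow_mul,
          mul_one_div_cancel hp.ne', ENNReal.rpow_one]

/-- A Hardy type inequality. -/
theorem lorentzFunctional_tsum_le {r : ℝ} (hr : 1 < r) {q : ℝ≥0∞} (hq : 0 < q) {C : ℝ≥0∞}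
    (hC : C ≠ ∞) :
    ∃ C' : ℝ≥0∞, C' ≠ ∞ ∧ ∀ V : ℝ → ℝ≥0∞, Measurable V →
      lorentzFunctional (fun lam => (C * ∑' k : ℕ, 2 ^ k * V (2 ^ k * lam)) ^ (1 / r)) q ≤
        C' * lorentzFunctional (fun lam => V lam ^ (1 / r)) q := by
  have hr0 : 0 < r := by linarith
  -- The sum is bounded by a supremum at the price of a geometric factor `w ^ k`. The loss `w⁻¹ ^ k
  -- * 2 ^ k` equals 2^(k(1+r)/2); its power 1/r, times the 2^(-k) from rescaling, is `θ ^ k`. The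
  -- exponent (1+r)/2 lies strictly between 1 and r, so both `w < 1` and `θ < 1`.
  set w : ℝ≥0∞ := 2 ^ ((1 - r) / 2)
  have hw1 : w < 1 := ENNReal.rpow_lt_one_of_one_lt_of_neg (by norm_num) (by linarith)
  have hw0 : w ≠ 0 := (ENNReal.rpow_pos (by norm_num) (by norm_num)).ne'
  have hwt : w ≠ ∞ := hw1.ne_top
  set θ : ℝ≥0∞ := 2 ^ ((1 + r) / 2 / r - 1)
  have hθ : θ < 1 := ENNReal.rpow_lt_one_of_one_lt_of_neg (by norm_num) (by
    have : (1 + r) / 2 / r < 1 := by rw [div_lt_one hr0]; linarith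
    linarith)
  obtain ⟨C₁, hC₁, hsup⟩ := lorentzFunctional_iSup_le hθ hq
  set S := C * (1 - w)⁻¹
  have hS : S ≠ ∞ := ENNReal.mul_ne_top hC (ENNReal.inv_ne_top.2 (tsub_pos_of_lt hw1).ne')
  have hS' : S ^ (1 / r) ≠ ∞ := ENNReal.rpow_ne_top_of_nonneg (by positivity) hS
  refine ⟨S ^ (1 / r) * C₁, ENNReal.mul_ne_top hS' hC₁, fun V hV => ?_⟩
  set E : ℕ → ℝ → ℝ≥0∞ := fun k lam => (w⁻¹ ^ k * 2 ^ k) ^ (1 / r) * V (2 ^ k * lam) ^ (1 / r)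
  have hpt : ∀ lam, (C * ∑' k : ℕ, 2 ^ k * V (2 ^ k * lam)) ^ (1 / r) ≤
      S ^ (1 / r) * ⨆ k, E k lam := by
    intro lam
    have h1 : ∑' k : ℕ, 2 ^ k * V (2 ^ k * lam) ≤
        (1 - w)⁻¹ * ⨆ k : ℕ, w⁻¹ ^ k * 2 ^ k * V (2 ^ k * lam) := by
      rw [← ENNReal.tsum_geometric, ← ENNReal.tsum_mul_right]
      refine ENNReal.tsum_le_tsum fun k => ?_
      calc 2 ^ k * V (2 ^ k * lam) = (w * w⁻¹) ^ k * 2 ^ k * V (2 ^ k * lam) := by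
            rw [ENNReal.mul_inv_cancel hw0 hwt, one_pow, one_mul]
        _ = w ^ k * (w⁻¹ ^ k * 2 ^ k * V (2 ^ k * lam)) := by rw [mul_pow]; ring
        _ ≤ _ := by
            gcongr
            exact le_iSup (fun k : ℕ => w⁻¹ ^ k * 2 ^ k * V (2 ^ k * lam)) k
    calc _ ≤ (S * ⨆ k : ℕ, w⁻¹ ^ k * 2 ^ k * V (2 ^ k * lam)) ^ (1 / r) := by
          refine ENNReal.rpow_le_rpow ?_ (by positivity)
          rw [mul_assoc]
          gcongr
      _ = S ^ (1 / r) * (⨆ k : ℕ, w⁻¹ ^ k * 2 ^ k * V (2 ^ k * lam)) ^ (1 / r) :=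
          ENNReal.mul_rpow_of_nonneg _ _ (by positivity)
      _ ≤ _ := by
          gcongr
          rw [← ENNReal.le_rpow_inv_iff (by positivity)]
          refine iSup_le fun k => ?_
          rw [ENNReal.le_rpow_inv_iff (by positivity),
            ENNReal.mul_rpow_of_nonneg _ _ (by positivity)]
          exact le_iSup (fun k => E k lam) k
  have hE : ∀ k, lorentzFunctional (E k) q ≤
      θ ^ k * lorentzFunctional (fun lam => V lam ^ (1 / r)) q := by
    intro k
    have hcoef : (w⁻¹ ^ k * 2 ^ k) ^ (1 / r) ≠ ∞ := ENNReal.rpow_ne_top_of_nonneg (by positivity)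
      (ENNReal.mul_ne_top (ENNReal.pow_ne_top (ENNReal.inv_ne_top.2 hw0)) (by simp))
    have hscal := lorentzFunctional_comp_mul_le (fun lam => V lam ^ (1 / r))
      (c := 2 ^ k) (by positivity) hq
    rw [lorentzFunctional_const_mul hcoef hq]
    refine (mul_le_mul_right hscal _).trans (le_of_eq ?_)
    rw [← mul_assoc]
    congr 1
    have h2 : ENNReal.ofReal (2 ^ k : ℝ)⁻¹ = 2 ^ (-(k : ℝ)) := by
      rw [ENNReal.ofReal_inv_of_pos (by positivity), ENNReal.ofReal_pow (by norm_num),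
        ENNReal.rpow_neg, ENNReal.rpow_natCast, ENNReal.ofReal_ofNat]
    rw [h2, ← ENNReal.rpow_neg, ← ENNReal.rpow_natCast, ← ENNReal.rpow_natCast,
      ← ENNReal.rpow_natCast, ← ENNReal.rpow_mul, ← ENNReal.rpow_mul,
      ← ENNReal.rpow_add _ _ (by norm_num) (by norm_num), ← ENNReal.rpow_mul,
      ← ENNReal.rpow_add _ _ (by norm_num) (by norm_num)]
    congr 1
    field_simp
    ring
  calc _ ≤ lorentzFunctional (fun lam => S ^ (1 / r) * ⨆ k, E k lam) q :=
        lorentzFunctional_mono (fun lam _ => hpt lam) q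
    _ = S ^ (1 / r) * lorentzFunctional (fun lam => ⨆ k, E k lam) q :=
        lorentzFunctional_const_mul hS' hq
    _ ≤ S ^ (1 / r) * (C₁ * lorentzFunctional (fun lam => V lam ^ (1 / r)) q) := by
        gcongr
        exact hsup E _ (fun k => ((hV.comp (measurable_const_mul _)).pow_const _).const_mul _) hE
    _ = _ := by rw [mul_assoc]

/-! ### Kernels and their dilates -/

theorem IsKernel.integrable {n : ℕ} {φ : Rn n → ℝ} (hφ : IsKernel φ) : Integrable φ volume := by
  obtain ⟨M, -, -, hint, hφM⟩ := hφ.majorant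
  refine hint.mono' hφ.measurable (Filter.Eventually.of_forall fun x => ?_)
  rw [Real.norm_of_nonneg (hφ.pos x).le]
  exact hφM x

theorem IsKernel.exists_bound {n : ℕ} {φ : Rn n → ℝ} (hφ : IsKernel φ) : ∃ B, ∀ x, φ x ≤ B := by
  obtain ⟨M, -, ⟨B, hB⟩, -, hφM⟩ := hφ.majorant
  exact ⟨B, fun x => (hφM x).trans (hB _ (norm_nonneg x))⟩

theorem lintegral_dilation_Rn {n : ℕ} (ψ : Rn n → ℝ≥0∞) (x : Rn n) {t : ℝ} (ht : 0 < t) :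
    ∫⁻ z, ENNReal.ofReal (t ^ n)⁻¹ * ψ (t⁻¹ • (x - z)) = ∫⁻ z, ψ z := by
  have ht' : t⁻¹ ≠ 0 := (inv_pos.2 ht).ne'
  rw [lintegral_sub_left_eq_self (fun z => ENNReal.ofReal (t ^ n)⁻¹ * ψ (t⁻¹ • z)) x,
    lintegral_const_mul' _ _ ENNReal.ofReal_ne_top]
  have h := lintegral_map_equiv (μ := volume) ψ
    (Homeomorph.smulOfNeZero (α := Rn n) t⁻¹ ht').toMeasurableEquiv
  have h2 : ⇑(Homeomorph.smulOfNeZero (α := Rn n) t⁻¹ ht').toMeasurableEquiv =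
      fun z => t⁻¹ • z := rfl
  rw [h2, Measure.map_addHaar_smul volume ht', lintegral_smul_measure,
    finrank_euclideanSpace_fin] at h
  rw [← h, smul_eq_mul, ← mul_assoc, ← ENNReal.ofReal_mul (by positivity), inv_pow, inv_inv,
    abs_of_pos (by positivity), inv_mul_cancel₀ (by positivity), ENNReal.ofReal_one, one_mul]

theorem ofReal_dilate {n : ℕ} (φ : Rn n → ℝ) {t : ℝ} (ht : 0 < t) (x : Rn n) :
    ENNReal.ofReal (dilate φ t x) =
      ENNReal.ofReal (t ^ n)⁻¹ * ENNReal.ofReal (φ (t⁻¹ • x)) :=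
  ENNReal.ofReal_mul (by positivity)

theorem IsKernel.dilate_pos {n : ℕ} {φ : Rn n → ℝ} (hφ : IsKernel φ) {t : ℝ} (ht : 0 < t)
    (x : Rn n) : 0 < dilate φ t x :=
  mul_pos (by positivity) (hφ.pos _)

theorem quasiMeasurePreserving_dilation_Rn {n : ℕ} (x : Rn n) {t : ℝ} (ht : 0 < t) :
    Measure.QuasiMeasurePreserving (fun z : Rn n => t⁻¹ • (x - z)) volume volume :=
  (Measure.quasiMeasurePreserving_smul volume (inv_pos.2 ht).ne').comp
    (quasiMeasurePreserving_sub_left_of_right_invariant volume x)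

theorem IsKernel.aestronglyMeasurable_dilate {n : ℕ} {φ : Rn n → ℝ} (hφ : IsKernel φ) (x : Rn n)
    {t : ℝ} (ht : 0 < t) : AEStronglyMeasurable (fun z => dilate φ t (x - z)) volume :=
  (hφ.measurable.comp_quasiMeasurePreserving
    (quasiMeasurePreserving_dilation_Rn x ht)).const_mul _

/-! ### Truncation at a level; existence and measurability of the convolution -/

section
variable {𝕜 : Type*} [RCLike 𝕜] {n : ℕ}

theorem convExt_eq (φ : Rn n → ℝ) (f : Rn n → 𝕜) (p : HalfSpace n) :
    convExt φ f p = ∫ z, dilate φ p.2 (p.1 - z) • f z := rfl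

theorem enorm_dilate_smul {φ : Rn n → ℝ} (hφ : IsKernel φ) {t : ℝ} (ht : 0 < t) (x : Rn n)
    (a : 𝕜) : ‖dilate φ t x • a‖ₑ = ‖a‖ₑ * ENNReal.ofReal (dilate φ t x) := by
  rw [enorm_smul, mul_comm, Real.enorm_of_nonneg (hφ.dilate_pos ht x).le]

theorem enorm_convExt_le {φ : Rn n → ℝ} (hφ : IsKernel φ) (f : Rn n → 𝕜) (p : HalfSpace n) :
    ‖convExt φ f p‖ₑ ≤ ∫⁻ z, ‖f z‖ₑ * ENNReal.ofReal (dilate φ p.2 (p.1 - z)) := by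
  rw [convExt_eq]
  refine (enorm_integral_le_lintegral_enorm _).trans (le_of_eq ?_)
  exact lintegral_congr fun z => enorm_dilate_smul hφ p.2.2 _ _

/-- The part of `‖f‖` above the level `lam`. -/
noncomputable def upperPart (f : Rn n → 𝕜) (lam : ℝ) : Rn n → ℝ≥0∞ :=
  {z | lam < ‖f z‖}.indicator fun z => ‖f z‖ₑ

theorem nullMeasurableSet_lt_norm {f : Rn n → 𝕜} (hf : AEStronglyMeasurable f volume) (lam : ℝ) :
    NullMeasurableSet {z | lam < ‖f z‖} volume :=
  nullMeasurableSet_lt aemeasurable_const hf.norm.aemeasurable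

theorem aemeasurable_upperPart {f : Rn n → 𝕜} (hf : AEStronglyMeasurable f volume) (lam : ℝ) :
    AEMeasurable (upperPart f lam) volume :=
  hf.enorm.indicator₀ (nullMeasurableSet_lt_norm hf lam)

theorem enorm_le_add_upperPart (f : Rn n → 𝕜) (lam : ℝ) (z : Rn n) :
    ‖f z‖ₑ ≤ ENNReal.ofReal lam + upperPart f lam z := by
  by_cases hz : lam < ‖f z‖
  · refine le_add_left ?_
    rw [upperPart, indicator_of_mem (show z ∈ {z | lam < ‖f z‖} from hz)]
  · refine le_add_right ?_
    rw [← ofReal_norm]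
    exact ENNReal.ofReal_le_ofReal (not_lt.1 hz)

theorem lintegral_mul_dilate_le {φ : Rn n → ℝ} (hφ : IsKernel φ) {f : Rn n → 𝕜}
    (lam : ℝ) (x : Rn n) {t : ℝ} (ht : 0 < t) :
    ∫⁻ z, ‖f z‖ₑ * ENNReal.ofReal (dilate φ t (x - z)) ≤
      ENNReal.ofReal lam * (∫⁻ z, ENNReal.ofReal (φ z)) +
        ∫⁻ z, upperPart f lam z * ENNReal.ofReal (dilate φ t (x - z)) := by
  have hk : AEMeasurable (fun z => ENNReal.ofReal (dilate φ t (x - z))) volume :=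
    (hφ.aestronglyMeasurable_dilate x ht).aemeasurable.ennreal_ofReal
  calc _ ≤ ∫⁻ z, (ENNReal.ofReal lam * ENNReal.ofReal (dilate φ t (x - z)) +
        upperPart f lam z * ENNReal.ofReal (dilate φ t (x - z))) := by
        refine lintegral_mono fun z => ?_
        simp only
        rw [← add_mul]
        gcongr
        exact enorm_le_add_upperPart f lam z
    _ = _ := by
        rw [lintegral_add_left' (hk.const_mul _), lintegral_const_mul' _ _ ENNReal.ofReal_ne_top,
          ← lintegral_dilation_Rn (fun z => ENNReal.ofReal (φ z)) x ht]
        simp_rw [ofReal_dilate φ ht]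

theorem exists_two_pow_lt_le {x : ℝ} (hx : 1 < x) : ∃ k : ℕ, 2 ^ k < x ∧ x ≤ 2 ^ (k + 1) := by
  classical
  have hex : ∃ m : ℕ, x ≤ 2 ^ m := (pow_unbounded_of_one_lt x one_lt_two).imp fun _ h => h.le
  obtain ⟨k, hk⟩ : ∃ k, Nat.find hex = k + 1 := Nat.exists_eq_succ_of_ne_zero fun h0 => by
    have := Nat.find_spec hex
    rw [h0, pow_zero] at this
    linarith
  refine ⟨k, not_le.1 (Nat.find_min hex (by omega)), ?_⟩
  rw [← hk]
  exact Nat.find_spec hex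

/-- A single term suffices: the k with 2^k lam < ‖f z‖ ≤ 2^(k+1) lam. The strict side of this
bracket matches the strict superlevel sets. -/
theorem upperPart_le_tsum (f : Rn n → 𝕜) {lam : ℝ} (hlam : 0 < lam) (z : Rn n) :
    upperPart f lam z ≤ ∑' k : ℕ, 2 * ENNReal.ofReal lam * 2 ^ k *
      {z | 2 ^ k * lam < ‖f z‖}.indicator (fun _ => 1) z := by
  by_cases hz : lam < ‖f z‖
  · obtain ⟨k, hk1, hk2⟩ := exists_two_pow_lt_le ((one_lt_div hlam).2 hz)
    rw [lt_div_iff₀ hlam] at hk1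
    rw [div_le_iff₀ hlam] at hk2
    refine le_trans ?_ (ENNReal.le_tsum k)
    rw [upperPart, indicator_of_mem (show z ∈ {z | lam < ‖f z‖} from hz),
      indicator_of_mem (show z ∈ {z | 2 ^ k * lam < ‖f z‖} from hk1), mul_one,
      ← ofReal_norm]
    refine (ENNReal.ofReal_le_ofReal hk2).trans (le_of_eq ?_)
    rw [ENNReal.ofReal_mul (by positivity), ENNReal.ofReal_pow (by norm_num),
      ENNReal.ofReal_ofNat, pow_succ]
    ring
  · have h0 : upperPart f lam z = 0 := indicator_of_notMem (s := {z | lam < ‖f z‖}) hz _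
    rw [h0]
    exact zero_le

theorem lintegral_upperPart_le {f : Rn n → 𝕜} (hf : AEStronglyMeasurable f volume) {lam : ℝ}
    (hlam : 0 < lam) :
    ∫⁻ z, upperPart f lam z ≤
      2 * ENNReal.ofReal lam * ∑' k : ℕ, 2 ^ k * volume {z | 2 ^ k * lam < ‖f z‖} := by
  calc _ ≤ ∫⁻ z, ∑' k : ℕ, 2 * ENNReal.ofReal lam * 2 ^ k *
      {z | 2 ^ k * lam < ‖f z‖}.indicator (fun _ => 1) z :=
        lintegral_mono fun z => upperPart_le_tsum f hlam z
    _ = _ := by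
        rw [lintegral_tsum fun k => (aemeasurable_const.indicator₀
          (nullMeasurableSet_lt_norm hf _)).const_mul _, ← ENNReal.tsum_mul_left]
        refine tsum_congr fun k => ?_
        rw [lintegral_const_mul'' _ (aemeasurable_const.indicator₀
          (nullMeasurableSet_lt_norm hf _)),
          lintegral_indicator_const₀ (nullMeasurableSet_lt_norm hf _), one_mul, mul_assoc]

theorem antitone_volume_lt_norm (f : Rn n → 𝕜) : Antitone fun lam => volume {z | lam < ‖f z‖} :=
  fun _ _ h => measure_mono fun _ hz => lt_of_le_of_lt h hz

/-- The Hardy inequality makes the Lorentz functional of the 1/r-th power of the sum finite, and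
this power is antitone in `lam`, so the weak bound makes it finite at each level. -/
theorem MemLorentz.tsum_ne_top {f : Rn n → 𝕜} {r : ℝ} {q : ℝ≥0∞} (hr : 1 < r) (hq : 0 < q)
    (hf : MemLorentz f r q) {lam : ℝ} (hlam : 0 < lam) :
    ∑' k : ℕ, 2 ^ k * volume {z | 2 ^ k * lam < ‖f z‖} ≠ ∞ := by
  obtain ⟨C', hC', h⟩ := lorentzFunctional_tsum_le hr hq (C := 1) (by simp)
  have hV := antitone_volume_lt_norm f
  have h1 := h (fun lam => volume {z | lam < ‖f z‖}) hV.measurable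
  have hr0 : 0 < r := by linarith
  have hanti : Antitone fun lam : ℝ =>
      (1 * ∑' k : ℕ, 2 ^ k * volume {z | 2 ^ k * lam < ‖f z‖}) ^ (1 / r) := by
    intro a b hab
    refine ENNReal.rpow_le_rpow ?_ (by positivity)
    gcongr
  have h2 := (mul_le_lorentzFunctional hanti hq hlam).trans h1
  intro htop
  rw [htop, one_mul, ENNReal.top_rpow_of_pos (by positivity), ENNReal.mul_top (by simpa using hlam),
    top_le_iff] at h2
  exact ENNReal.mul_ne_top hC' hf.2.ne h2

/-- Split `f` at level 1: the lower part is bounded against an integrable kernel, the upper part is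
integrable against a bounded one. -/
theorem MemLorentz.lintegral_mul_dilate_ne_top {φ : Rn n → ℝ} (hφ : IsKernel φ) {f : Rn n → 𝕜}
    {r : ℝ} {q : ℝ≥0∞} (hr : 1 < r) (hq : 0 < q) (hf : MemLorentz f r q) (x : Rn n) {t : ℝ}
    (ht : 0 < t) :
    ∫⁻ z, ‖f z‖ₑ * ENNReal.ofReal (dilate φ t (x - z)) ≠ ∞ := by
  obtain ⟨B, hB⟩ := hφ.exists_bound
  refine ne_top_of_le_ne_top ?_ (lintegral_mul_dilate_le hφ 1 x ht)
  refine ENNReal.add_ne_top.2 ⟨ENNReal.mul_ne_top ENNReal.ofReal_ne_top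
    hφ.integrable.lintegral_lt_top.ne, ?_⟩
  refine ne_top_of_le_ne_top (b := (∫⁻ z, upperPart f 1 z) * ENNReal.ofReal ((t ^ n)⁻¹ * B)) ?_ ?_
  · refine ENNReal.mul_ne_top (ne_top_of_le_ne_top ?_ (lintegral_upperPart_le hf.1 one_pos))
      ENNReal.ofReal_ne_top
    exact ENNReal.mul_ne_top (by simp) (hf.tsum_ne_top hr hq one_pos)
  · rw [← lintegral_mul_const' _ _ ENNReal.ofReal_ne_top]
    refine lintegral_mono fun z => ?_
    simp only
    gcongr
    exact mul_le_mul_of_nonneg_left (hB _) (by positivity)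

theorem MemLorentz.convolutionExistsAt {φ : Rn n → ℝ} (hφ : IsKernel φ) {f : Rn n → 𝕜}
    {r : ℝ} {q : ℝ≥0∞} (hr : 1 < r) (hq : 0 < q) (hf : MemLorentz f r q) (x : Rn n) {t : ℝ}
    (ht : 0 < t) :
    ConvolutionExistsAt f (dilate φ t) x (ContinuousLinearMap.lsmul ℝ ℝ).flip volume := by
  change Integrable (fun z => dilate φ t (x - z) • f z) volume
  refine ⟨(hφ.aestronglyMeasurable_dilate x ht).smul hf.1, ?_⟩
  rw [HasFiniteIntegral, lt_top_iff_ne_top]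
  simp_rw [enorm_dilate_smul hφ ht]
  exact hf.lintegral_mul_dilate_ne_top hφ hr hq x ht

theorem stronglyMeasurable_convExt {φ : Rn n → ℝ} (hφ : IsKernel φ) {f : Rn n → 𝕜}
    (hf : AEStronglyMeasurable f volume) : StronglyMeasurable (convExt φ f) := by
  -- Measurable representatives of `φ` and `f` give the same integral at every point, not just
  -- almost every one, because z ↦ (x - z)/t pulls null sets back to null sets.
  have heq : convExt φ f = fun p : HalfSpace n =>
      ∫ z, dilate (hφ.measurable.mk φ) p.2 (p.1 - z) • hf.mk f z := by
    funext p
    rw [convExt_eq]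
    refine integral_congr_ae ?_
    filter_upwards [hf.ae_eq_mk, (quasiMeasurePreserving_dilation_Rn p.1 p.2.2).ae
      hφ.measurable.ae_eq_mk] with z h1 h2
    rw [← h1, dilate, dilate, h2]
  rw [heq]
  refine StronglyMeasurable.integral_prod_right (f := fun (p : HalfSpace n) (z : Rn n) =>
    dilate (hφ.measurable.mk φ) p.2 (p.1 - z) • hf.mk f z) ?_
  refine StronglyMeasurable.smul ?_ (hf.stronglyMeasurable_mk.comp_measurable measurable_snd)
  refine Measurable.stronglyMeasurable ?_
  have h := hφ.measurable.stronglyMeasurable_mk.measurable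
  refine Measurable.mul ?_ (h.comp ?_)
  · fun_prop
  · fun_prop

end

/-! ### Tents and superlevel sets -/

section
variable {𝕜 : Type*} [RCLike 𝕜] {n : ℕ}

/-- An open set misses its frontier, so the frontier is at distance at least 2t; the radius 2t
leaves room for the strict inequality in `tent`. -/
theorem mem_tent_of_ball_subset {O : Set (Rn n)} (hO : IsOpen O) {p : HalfSpace n}
    (h : Metric.ball p.1 (2 * p.2) ⊆ O) : p ∈ tent O := by
  have ht : (0 : ℝ) < p.2 := p.2.2
  refine ⟨h (Metric.mem_ball_self (by positivity)), ?_⟩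
  refine lt_of_lt_of_le (b := ENNReal.ofReal (2 * p.2)) ?_ ?_
  · exact (ENNReal.ofReal_lt_ofReal_iff (by positivity)).2 (by linarith)
  · refine Metric.le_infEDist.2 fun y hy => ?_
    by_contra! hlt
    rw [edist_lt_ofReal, dist_comm] at hlt
    have : y ∈ O ∩ frontier O := ⟨h hlt, hy⟩
    rw [hO.inter_frontier_eq] at this
    exact this

/-- The ball is connected and misses the frontier, so it stays on the side of its centre. -/
theorem ball_subset_of_mem_tent {O : Set (Rn n)} (hO : IsOpen O) {p : HalfSpace n}
    (h : p ∈ tent O) : Metric.ball p.1 p.2 ⊆ O := by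
  have ht : (0 : ℝ) < p.2 := p.2.2
  refine (convex_ball p.1 (p.2 : ℝ)).isPreconnected.subset_left_of_subset_union hO
    (isClosed_closure (s := O)).isOpen_compl
    (disjoint_compl_right.mono_right (compl_subset_compl.2 subset_closure)) (fun y hy => ?_)
    ⟨p.1, Metric.mem_ball_self ht, h.1⟩
  by_cases hyO : y ∈ O
  · exact Or.inl hyO
  · refine Or.inr fun hyc => ?_
    have hyf : y ∈ frontier O := ⟨hyc, by rwa [hO.interior_eq]⟩
    have h1 := h.2.trans_le (Metric.infEDist_le_edist_of_mem hyf)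
    rw [edist_dist, ENNReal.ofReal_lt_ofReal_iff_of_nonneg ht.le, dist_comm] at h1
    exact absurd hy (not_lt.2 h1.le)

/-- The superlevel sets of `f ∗ φ_t` lie in tents over open sets of controlled size. -/
theorem exists_tent_cover (hn : 0 < n) {φ : Rn n → ℝ} (hφ : IsKernel φ) :
    ∃ (C₀ : ℝ) (C₁ : ℝ≥0∞), 0 < C₀ ∧ C₁ ≠ ∞ ∧ ∀ f : Rn n → 𝕜, AEStronglyMeasurable f volume →
      ∀ lam : ℝ, 0 < lam → ∑' k : ℕ, 2 ^ k * volume {z | 2 ^ k * lam < ‖f z‖} ≠ ∞ →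
      ∃ O : Set (Rn n), IsOpen O ∧ {p | C₀ * lam < ‖convExt φ f p‖} ⊆ tent O ∧
        volume O ≤ C₁ * ∑' k : ℕ, 2 ^ k * volume {z | 2 ^ k * lam < ‖f z‖} := by
  obtain ⟨A, hA, hmax⟩ := lintegral_dilate_le_maximalFn hn hφ
  set I := ∫⁻ z, ENNReal.ofReal (φ z)
  have hI : I ≠ ∞ := hφ.integrable.lintegral_lt_top.ne
  -- Of (I + 1) lam, the lower part of `f` uses up I lam, leaving lam for the upper part. In the
  -- second constant, `5 ^ n * volume` of the unit ball is the weak type constant, 2 is the dyadic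
  -- loss, and `A + 1` replaces `A` to permit division.
  refine ⟨I.toReal + 1, 5 ^ n * volume (Metric.ball (0 : Rn n) 1) * (A + 1) * 2, by positivity,
    ENNReal.mul_ne_top (ENNReal.mul_ne_top (ENNReal.mul_ne_top (by simp)
      measure_ball_lt_top.ne) (by simp [hA])) (by simp), fun f hf lam hlam hW => ?_⟩
  set W := ∑' k : ℕ, 2 ^ k * volume {z | 2 ^ k * lam < ‖f z‖}
  have hG := lintegral_upperPart_le hf hlam
  have hG' : ∫⁻ z, upperPart f lam z ≠ ∞ :=
    ne_top_of_le_ne_top (ENNReal.mul_ne_top (ENNReal.mul_ne_top (by simp) (by simp)) hW) hG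
  have hA1 : A + 1 ≠ ∞ := by simp [hA]
  have hl0 : ENNReal.ofReal lam ≠ 0 := by simpa using hlam
  set O : Set (Rn n) := ⋃ (p : HalfSpace n) (_ : (I.toReal + 1) * lam < ‖convExt φ f p‖),
    Metric.ball p.1 (2 * p.2)
  have hO : IsOpen O := isOpen_iUnion fun p => isOpen_iUnion fun _ => Metric.isOpen_ball
  refine ⟨O, hO, fun p hp => mem_tent_of_ball_subset hO ?_, ?_⟩
  · exact subset_iUnion₂ (s := fun (p : HalfSpace n)
      (_ : (I.toReal + 1) * lam < ‖convExt φ f p‖) => Metric.ball p.1 (2 * p.2)) p hp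
  have hsub : O ⊆ {x | ENNReal.ofReal lam / (A + 1) < maximalFn (upperPart f lam) x} := by
    intro x hx
    obtain ⟨p, hp, hxp⟩ := mem_iUnion₂.1 hx
    have h1 : ENNReal.ofReal lam * I + ENNReal.ofReal lam < ‖convExt φ f p‖ₑ := by
      rw [← ofReal_norm]
      refine lt_of_le_of_lt (le_of_eq ?_) ((ENNReal.ofReal_lt_ofReal_iff_of_nonneg
        (by positivity)).2 hp)
      rw [add_mul, one_mul, ENNReal.ofReal_add (by positivity) hlam.le,
        ENNReal.ofReal_mul (by positivity), ENNReal.ofReal_toReal hI, mul_comm]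
    have h2 := h1.trans_le ((enorm_convExt_le hφ f p).trans
      (lintegral_mul_dilate_le hφ lam p.1 p.2.2))
    have h3 := (lt_of_add_lt_add_left h2).trans_le
      (hmax _ (aemeasurable_upperPart hf lam) x p.1 p.2 p.2.2 hxp)
    show ENNReal.ofReal lam / (A + 1) < _
    rw [ENNReal.div_lt_iff (Or.inl (by simp)) (Or.inl hA1), mul_comm]
    refine h3.trans_le ?_
    gcongr
    exact le_self_add
  calc volume O ≤ _ := measure_mono hsub
    _ ≤ 5 ^ n * volume (Metric.ball (0 : Rn n) 1) * (ENNReal.ofReal lam / (A + 1))⁻¹ *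
        ∫⁻ z, upperPart f lam z := volume_lt_maximalFn_le hn hG'
          (ENNReal.div_pos hl0 hA1).ne' (ENNReal.div_lt_top (by simp) (by simp)).ne
    _ ≤ 5 ^ n * volume (Metric.ball (0 : Rn n) 1) * (ENNReal.ofReal lam / (A + 1))⁻¹ *
        (2 * ENNReal.ofReal lam * W) := by gcongr
    _ = 5 ^ n * volume (Metric.ball (0 : Rn n) 1) * (A + 1) * 2 * W *
        ((ENNReal.ofReal lam)⁻¹ * ENNReal.ofReal lam) := by
        rw [ENNReal.inv_div (Or.inl hA1) (Or.inl (by simp)), div_eq_mul_inv]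
        ring
    _ = _ := by rw [ENNReal.inv_mul_cancel hl0 (by simp), mul_one]

/-! ### The inverse gauge and the direct estimate -/

theorem gaugeInv_le {Ψ : ℝ≥0 → ℝ≥0} {y : ℝ≥0∞} {s : ℝ≥0} (h : y ≤ Ψ s) : gaugeInv Ψ y ≤ s :=
  iInf₂_le (f := fun (s : ℝ≥0) (_ : y ≤ (Ψ s : ℝ≥0∞)) => (s : ℝ≥0∞)) s h

theorem gaugeInv_mono (Ψ : ℝ≥0 → ℝ≥0) : Monotone (gaugeInv Ψ) := fun _ _ h =>
  le_iInf₂ fun _ hs => gaugeInv_le (h.trans hs)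

/-- The inequality must be strict: Ψ may jump, so the infimum defining the inverse need not be
attained. -/
theorem le_of_gaugeInv_lt {Ψ : ℝ≥0 → ℝ≥0} (hΨ : Monotone Ψ) {y : ℝ≥0∞} {s : ℝ≥0}
    (h : gaugeInv Ψ y < s) : y ≤ Ψ s := by
  obtain ⟨s', hs'⟩ := iInf_lt_iff.1 h
  obtain ⟨h1, h2⟩ := iInf_lt_iff.1 hs'
  exact h1.trans (by exact_mod_cast hΨ (by exact_mod_cast h2.le))

/-- The convolution estimate from a tent estimate with `Ψ` itself. -/
theorem convEstimate_of_tent_le (hn : 0 < n) {Ψ : ℝ≥0 → ℝ≥0} {μ : Measure (HalfSpace n)} (a : ℝ≥0)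
    (h : ∀ O : Set (Rn n), IsOpen O → volume O ≠ ∞ →
      μ (tent O) ≤ Ψ (a * (volume O).toNNReal ^ ((1 : ℝ) / n)))
    {φ : Rn n → ℝ} (hφ : IsKernel φ) {r : ℝ} (hr : 1 < r) {q : ℝ≥0∞} (hq : 0 < q) :
    ConvEstimate 𝕜 μ φ Ψ r q := by
  have hr0 : 0 < r := by linarith
  have hn' : (n : ℝ) ≠ 0 := by exact_mod_cast hn.ne'
  obtain ⟨C₀, C₁, hC₀, hC₁, hcov⟩ := exists_tent_cover (𝕜 := 𝕜) hn hφ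
  have hC : (a : ℝ≥0∞) ^ (n : ℝ) * C₁ ≠ ∞ :=
    ENNReal.mul_ne_top (ENNReal.rpow_ne_top_of_nonneg (by positivity) (by simp)) hC₁
  obtain ⟨C₂, hC₂, hhardy⟩ := lorentzFunctional_tsum_le hr hq hC
  refine ⟨(ENNReal.ofReal C₀ * C₂).toNNReal, fun f hf => ?_⟩
  rw [ENNReal.coe_toNNReal (ENNReal.mul_ne_top (by simp) hC₂)]
  have hpt : ∀ lam : ℝ, 0 < lam →
      gaugeInv Ψ (μ {p | C₀ * lam < ‖convExt φ f p‖}) ^ (n / r) ≤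
      ((a : ℝ≥0∞) ^ (n : ℝ) * C₁ * ∑' k : ℕ, 2 ^ k * volume {z | 2 ^ k * lam < ‖f z‖}) ^
        (1 / r) := by
    intro lam hlam
    have hW := hf.tsum_ne_top hr hq hlam
    obtain ⟨O, hO, hsub, hvol⟩ := hcov f hf.1 lam hlam hW
    have hvt : volume O ≠ ∞ := ne_top_of_le_ne_top (ENNReal.mul_ne_top hC₁ hW) hvol
    have h1 := gaugeInv_le ((measure_mono hsub).trans (h O hO hvt))
    rw [show (n : ℝ) / r = n * (1 / r) by ring, ENNReal.rpow_mul]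
    refine ENNReal.rpow_le_rpow ?_ (by positivity)
    calc _ ≤ ((a * (volume O).toNNReal ^ ((1 : ℝ) / n) : ℝ≥0) : ℝ≥0∞) ^ (n : ℝ) :=
          ENNReal.rpow_le_rpow h1 (by positivity)
      _ = (a : ℝ≥0∞) ^ (n : ℝ) * volume O := by
          rw [ENNReal.coe_mul, ENNReal.coe_rpow_of_nonneg _ (by positivity),
            ENNReal.coe_toNNReal hvt, ENNReal.mul_rpow_of_nonneg _ _ (by positivity),
            ← ENNReal.rpow_mul, one_div_mul_cancel hn', ENNReal.rpow_one]
      _ ≤ _ := by rw [mul_assoc]; gcongr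
  -- Rescaling the level moves `C₀` out of the superlevel set; the pointwise bound and the Hardy
  -- inequality then apply.
  calc weightedLorentzNorm μ Ψ (n / r) q (convExt φ f)
      ≤ ENNReal.ofReal C₀ * lorentzFunctional (fun lam =>
          gaugeInv Ψ (μ {p | C₀ * lam < ‖convExt φ f p‖}) ^ (n / r)) q :=
        lorentzFunctional_le_comp_mul _ hC₀ hq
    _ ≤ ENNReal.ofReal C₀ * (C₂ * lorentzNorm f r q) := by
        gcongr
        exact (lorentzFunctional_mono hpt q).trans
          (hhardy (fun lam => volume {z | lam < ‖f z‖}) (antitone_volume_lt_norm f).measurable)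
    _ = _ := by rw [mul_assoc]

/-! ### The converse: testing on indicator functions -/

/-- On the tent over `O`, the extension of the indicator function of `O` is bounded below. -/
theorem le_norm_convExt_indicator {φ : Rn n → ℝ} (hφ : IsKernel φ) {O : Set (Rn n)}
    (hO : IsOpen O) {p : HalfSpace n} (hp : p ∈ tent O) :
    ∫⁻ z in Metric.ball (0 : Rn n) 1, ENNReal.ofReal (φ z) ≤
      ‖convExt φ (O.indicator fun _ => (1 : 𝕜)) p‖ₑ := by
  obtain ⟨x, t, ht⟩ := p
  have ht : 0 < t := ht
  set g : Rn n → ℝ := O.indicator fun z => dilate φ t (x - z)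
  have hg0 : ∀ z, 0 ≤ g z := fun z => indicator_nonneg (fun _ _ => (hφ.dilate_pos ht _).le) z
  have hdi : Integrable (fun z => dilate φ t (x - z)) volume := by
    refine ⟨hφ.aestronglyMeasurable_dilate x ht, ?_⟩
    have h1 := lintegral_dilation_Rn (fun z => ENNReal.ofReal (φ z)) x ht
    simp_rw [← ofReal_dilate φ ht] at h1
    rw [HasFiniteIntegral]
    simp_rw [Real.enorm_of_nonneg (hφ.dilate_pos ht _).le]
    rw [h1]
    exact hφ.integrable.lintegral_lt_top
  have hgi : Integrable g volume := hdi.indicator hO.measurableSet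
  have hconv : convExt φ (O.indicator fun _ => (1 : 𝕜)) (⟨x, t, ht⟩ : HalfSpace n) =
      ((∫ z, g z : ℝ) : 𝕜) := by
    rw [convExt_eq, ← integral_ofReal]
    congr 1
    funext z
    by_cases hz : z ∈ O
    · simp [g, hz, RCLike.real_smul_eq_coe_mul]
    · simp [g, hz]
  rw [hconv, ← ofReal_norm, RCLike.norm_ofReal, abs_of_nonneg (integral_nonneg hg0),
    ofReal_integral_eq_lintegral_ofReal hgi (Filter.Eventually.of_forall hg0),
    ← lintegral_indicator Metric.isOpen_ball.measurableSet, ← lintegral_dilation_Rn _ x ht]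
  refine lintegral_mono fun z => ?_
  simp only
  by_cases hz : t⁻¹ • (x - z) ∈ Metric.ball (0 : Rn n) 1
  · have hzO : z ∈ O := by
      refine ball_subset_of_mem_tent hO hp ?_
      rw [mem_ball_zero_iff, norm_smul, norm_inv, Real.norm_of_nonneg ht.le, ← div_eq_inv_mul,
        div_lt_one ht] at hz
      rw [mem_ball_iff_norm, norm_sub_rev]
      exact hz
    rw [indicator_of_mem hz, ← ofReal_dilate φ ht]
    simp only [g, indicator_of_mem hzO]
    exact le_rfl
  · rw [indicator_of_notMem hz, mul_zero]
    exact zero_le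

end

theorem lorentzNorm_indicator_le {𝕜 : Type*} [RCLike 𝕜] {n : ℕ} (O : Set (Rn n)) {r : ℝ}
    (hr : 0 < r) {q : ℝ≥0∞} (hq : 0 < q) :
    lorentzNorm (O.indicator fun _ => (1 : 𝕜)) r q ≤ volume O ^ (1 / r) := by
  refine lorentzFunctional_le_of_support (fun lam hlam => ?_) (fun lam hlam => ?_) hq
  · refine ENNReal.rpow_le_rpow (measure_mono fun z hz => ?_) (by positivity)
    by_contra hzO
    simp only [mem_ofPred_eq, indicator_of_notMem hzO, norm_zero] at hz
    linarith
  · have : {z | lam < ‖O.indicator (fun _ => (1 : 𝕜)) z‖} = ∅ := by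
      rw [Set.eq_empty_iff_forall_notMem]
      intro z hz
      have h1 : ‖O.indicator (fun _ => (1 : 𝕜)) z‖ ≤ 1 := by
        by_cases hzO : z ∈ O <;> simp [hzO]
      exact absurd (lt_of_lt_of_le hz h1) (not_lt.2 hlam)
    rw [this, measure_empty, ENNReal.zero_rpow_of_pos (by positivity)]

theorem memV_of_convEstimate {𝕜 : Type*} [RCLike 𝕜] {n : ℕ} (hn : 0 < n) {Φ Ψ : ℝ≥0 → ℝ≥0}
    (hΦ : IsGauge Φ) (hΨ : StrictMono Ψ) (hΨΦ : Comparable Ψ Φ) {μ : Measure (HalfSpace n)}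
    {φ : Rn n → ℝ} (hφ : IsKernel φ) {r : ℝ} (hr : 1 < r) {q : ℝ≥0∞} (hq : 0 < q)
    (h : ConvEstimate 𝕜 μ φ Ψ r q) : MemV Φ μ := by
  obtain ⟨C, hC⟩ := h
  have hr0 : 0 < r := by linarith
  have hn' : (0 : ℝ) < n := by exact_mod_cast hn
  set κ := ∫⁻ z in Metric.ball (0 : Rn n) 1, ENNReal.ofReal (φ z) with hκdef
  have hκ0 : κ ≠ 0 := by
    intro h0
    rw [hκdef, lintegral_eq_zero_iff' hφ.measurable.aemeasurable.ennreal_ofReal.restrict] at h0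
    have hfalse : ∀ᵐ _ ∂(volume.restrict (Metric.ball (0 : Rn n) 1)), False := by
      filter_upwards [h0] with z hz
      exact (ENNReal.ofReal_pos.2 (hφ.pos z)).ne' hz
    rw [Filter.eventually_false_iff_eq_bot, ae_eq_bot, Measure.restrict_eq_zero] at hfalse
    exact (Metric.measure_ball_pos volume (0 : Rn n) one_pos).ne' hfalse
  have hκ1 : κ ≠ ∞ :=
    ne_top_of_le_ne_top hφ.integrable.lintegral_lt_top.ne (setLIntegral_le_lintegral _ _)
  have hκ : 0 < κ.toReal := ENNReal.toReal_pos hκ0 hκ1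
  have hκ2 : ENNReal.ofReal (κ.toReal / 2) ≠ 0 := by simpa using hκ
  -- The exponent r/n undoes the power n/r in the weak estimate at level κ/2. Half of κ is taken
  -- because the superlevel sets are strict.
  set c : ℝ≥0∞ := (C / ENNReal.ofReal (κ.toReal / 2)) ^ (r / n)
  have hc : c ≠ ∞ := ENNReal.rpow_ne_top_of_nonneg (by positivity)
    (ENNReal.div_ne_top (by simp) hκ2)
  obtain ⟨C₁, hC₁⟩ := hΨΦ.1
  obtain ⟨C₂, hC₂⟩ := (hΦ.dilation (c.toNNReal + 1) (by positivity)).1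
  refine ⟨C₁ * C₂, fun O hO hvol => ?_⟩
  -- The null case is separate: passing from c s to the strictly larger (c + 1) s below needs s > 0.
  rcases eq_or_ne (volume O) 0 with h0 | h0
  · have : O = ∅ := (hO.measure_eq_zero_iff volume).1 h0
    have ht : tent O = ∅ := by
      rw [Set.eq_empty_iff_forall_notMem]
      intro p hp
      have := hp.1
      simp_all
    rw [ht, measure_empty]
    exact zero_le
  set s : ℝ≥0 := (volume O).toNNReal ^ ((1 : ℝ) / n) with hs
  have hs' : (s : ℝ≥0∞) = volume O ^ ((1 : ℝ) / n) := by
    rw [hs, ENNReal.coe_rpow_of_nonneg _ (by positivity), ENNReal.coe_toNNReal hvol]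
  have hs0 : 0 < s := NNReal.rpow_pos (ENNReal.toNNReal_pos h0 hvol)
  set f : Rn n → 𝕜 := O.indicator fun _ => (1 : 𝕜)
  have hnorm : lorentzNorm f r q ≤ volume O ^ (1 / r) := lorentzNorm_indicator_le O hr0 hq
  have hf : MemLorentz f r q := ⟨(stronglyMeasurable_const.indicator
    hO.measurableSet).aestronglyMeasurable, hnorm.trans_lt
      (ENNReal.rpow_lt_top_of_nonneg (by positivity) hvol)⟩
  have hsub : tent O ⊆ {p | κ.toReal / 2 < ‖convExt φ f p‖} := by
    intro p hp
    have h1 := le_norm_convExt_indicator (𝕜 := 𝕜) hφ hO hp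
    rw [← ofReal_norm, ← hκdef, ENNReal.le_ofReal_iff_toReal_le hκ1 (norm_nonneg _)] at h1
    show κ.toReal / 2 < _
    linarith
  have hanti : Antitone fun lam => gaugeInv Ψ (μ {p | lam < ‖convExt φ f p‖}) ^ ((n : ℝ) / r) :=
    fun _ _ hab => ENNReal.rpow_le_rpow (gaugeInv_mono Ψ
      (measure_mono fun _ hp => lt_of_le_of_lt hab hp)) (by positivity)
  have hmain : gaugeInv Ψ (μ (tent O)) ≤ c * s := by
    have h1 := mul_le_lorentzFunctional hanti hq (half_pos hκ)
    have h2 := h1.trans ((hC f hf).trans (mul_le_mul_right hnorm _))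
    have h3 : gaugeInv Ψ (μ (tent O)) ^ ((n : ℝ) / r) ≤
        C / ENNReal.ofReal (κ.toReal / 2) * volume O ^ (1 / r) := by
      rw [← ENNReal.mul_div_right_comm,
        ENNReal.le_div_iff_mul_le (Or.inl hκ2) (Or.inl (by simp)), mul_comm]
      refine le_trans ?_ h2
      gcongr
      exact gaugeInv_mono Ψ (measure_mono hsub)
    rw [← ENNReal.le_rpow_inv_iff (by positivity), inv_div,
      ENNReal.mul_rpow_of_nonneg _ _ (by positivity), ← ENNReal.rpow_mul] at h3
    rw [hs']
    refine h3.trans (le_of_eq ?_)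
    congr 2
    field_simp
  have hlt : gaugeInv Ψ (μ (tent O)) < (((c.toNNReal + 1) * s : ℝ≥0) : ℝ≥0∞) := by
    refine hmain.trans_lt ?_
    rw [← ENNReal.coe_toNNReal hc, ← ENNReal.coe_mul, ENNReal.coe_lt_coe, ENNReal.toNNReal_coe]
    gcongr
    exact lt_add_one _
  refine (le_of_gaugeInv_lt hΨ.monotone hlt).trans (ENNReal.coe_le_coe.2 ?_)
  calc Ψ ((c.toNNReal + 1) * s) ≤ C₁ * Φ ((c.toNNReal + 1) * s) := hC₁ _
    _ ≤ C₁ * (C₂ * Φ s) := by gcongr; exact hC₂ s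
    _ = C₁ * C₂ * Φ s := by rw [mul_assoc]

/-! ### Absorbing constants and the conclusion -/

/-- Under the growth condition any constant factor outside Φ can be traded for a dilation inside. -/
theorem two_pow_mul_le {Φ : ℝ≥0 → ℝ≥0} {A : ℝ≥0} (hA : ∀ s, 2 * Φ s ≤ Φ (A * s)) (m : ℕ)
    (s : ℝ≥0) : 2 ^ m * Φ s ≤ Φ (A ^ m * s) := by
  induction m with
  | zero => simp
  | succ m ih =>
    calc 2 ^ (m + 1) * Φ s = 2 * (2 ^ m * Φ s) := by ring
      _ ≤ 2 * Φ (A ^ m * s) := by gcongr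
      _ ≤ Φ (A * (A ^ m * s)) := hA _
      _ = _ := by rw [← mul_assoc, ← pow_succ']

theorem mainTheorem10 (𝕜 : Type*) [RCLike 𝕜] (n : ℕ) (hn : 0 < n)
    (Φ : ℝ≥0 → ℝ≥0) (hΦ : IsGauge Φ)
    (Ψ : ℝ≥0 → ℝ≥0) (hΨ : StrictMono Ψ) (hΨΦ : Comparable Ψ Φ)
    (μ : Measure (HalfSpace n)) :
    -- the convolutions exist and are measurable on the half-space
    (∀ φ : Rn n → ℝ, IsKernel φ → ∀ r : ℝ, 1 < r → ∀ q : ℝ≥0∞, 0 < q →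
      ∀ f : Rn n → 𝕜, MemLorentz f r q →
        (∀ (x : Rn n) (t : ℝ), 0 < t → ConvolutionExistsAt f (dilate φ t) x
          (ContinuousLinearMap.lsmul ℝ ℝ).flip volume) ∧
        StronglyMeasurable (convExt φ f)) ∧
    -- direct part, the constant multiple `K Ψ` being again equivalent to `Φ`
    (MemV Φ μ → ∃ K : ℝ≥0, 0 < K ∧ ∀ φ : Rn n → ℝ, IsKernel φ →
      ∀ r : ℝ, 1 < r → ∀ q : ℝ≥0∞, 0 < q → ConvEstimate 𝕜 μ φ (fun s => K * Ψ s) r q) ∧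
    -- direct part with `Ψ` itself, if `Φ` has some growth
    ((∃ A : ℝ≥0, ∀ s, 2 * Φ s ≤ Φ (A * s)) → MemV Φ μ → ∀ φ : Rn n → ℝ, IsKernel φ →
      ∀ r : ℝ, 1 < r → ∀ q : ℝ≥0∞, 0 < q → ConvEstimate 𝕜 μ φ Ψ r q) ∧
    -- converse part
    (∀ φ : Rn n → ℝ, IsKernel φ → ∀ r : ℝ, 1 < r → ∀ q : ℝ≥0∞, 0 < q →
      ConvEstimate 𝕜 μ φ Ψ r q → MemV Φ μ) := by
  obtain ⟨C₂, hC₂⟩ := hΨΦ.2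
  refine ⟨fun φ hφ r hr q hq f hf => ⟨fun x t ht => hf.convolutionExistsAt hφ hr hq x ht,
    stronglyMeasurable_convExt hφ hf.1⟩, ?_, ?_, ?_⟩
  · rintro ⟨C, hC⟩
    refine ⟨C * C₂ + 1, by positivity, fun φ hφ r hr q hq =>
      convEstimate_of_tent_le hn 1 (fun O hO hvol => (hC O hO hvol).trans ?_) hφ hr hq⟩
    rw [one_mul, ENNReal.coe_le_coe]
    set s := (volume O).toNNReal ^ ((1 : ℝ) / n)
    calc C * Φ s ≤ C * (C₂ * Ψ s) := by gcongr; exact hC₂ s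
      _ = C * C₂ * Ψ s := by rw [mul_assoc]
      _ ≤ _ := by gcongr; exact le_self_add
  · rintro ⟨A, hA⟩ ⟨C, hC⟩ φ hφ r hr q hq
    -- The power 2^m beats both the V^Φ constant and the comparison constant; `C₂ + 1` instead of
    -- `C₂` makes it cancellable.
    obtain ⟨m, hm⟩ := pow_unbounded_of_one_lt (C * (C₂ + 1)) (one_lt_two : (1 : ℝ≥0) < 2)
    refine convEstimate_of_tent_le hn (A ^ m) (fun O hO hvol => (hC O hO hvol).trans ?_) hφ hr hq
    rw [ENNReal.coe_le_coe]
    set s := (volume O).toNNReal ^ ((1 : ℝ) / n)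
    refine le_of_mul_le_mul_left (a := C₂ + 1) ?_ (by positivity)
    calc (C₂ + 1) * (C * Φ s) = C * (C₂ + 1) * Φ s := by ring
      _ ≤ 2 ^ m * Φ s := by gcongr
      _ ≤ Φ (A ^ m * s) := two_pow_mul_le hA m s
      _ ≤ C₂ * Ψ (A ^ m * s) := hC₂ _
      _ ≤ _ := by gcongr; exact le_self_add
  · exact fun φ hφ r hr q hq h => memV_of_convEstimate hn hΦ hΨ hΨΦ hφ hr hq h
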